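/- Let $d\ge 1$ and equip $[0,1]^d$ with the $\ell_\infty$ metric. An online synthetic data algorithm is a randomized algorithm which, on an infinite data stream $x_1,x_2,\dots\in[0,1]^d$, outputs at each time $t\ge 1$ a dataset $\mathcal Y_t=(y_{1,t},\dots,y_{t,t})$ of $t$ points of $[0,1]^d$, computed from $\mathcal X_t=(x_1,\dots,x_t)$ and the algorithm's internal randomness only (the randomness may be shared between different times). It is $\varepsilon$-differentially private if for any two streams $x,x'$ that differ in at most one coordinate, and any measurable set $S$ of infinite output sequences, $\mathbb P\big((\mathcal Y_t(x))_{t\ge1}\in S\big)\le e^{\varepsilon}\,\mathbb P\big((\mathcal Y_t(x'))_{t\ge1}\in S\big)$. Write $\mu_{\mathcal X_t}=\frac1t\sum_{i=1}^t\delta_{x_i}$, $\mu_{\mathcal Y_t}=\frac1t\sum_{i=1}^t\delta_{y_{i,t}}$, and let $W_1$ be the $1$-Wasserstein distance. Theorem. For every $d\ge 1$ there is a constant $C_d>0$, depending only on $d$, such that for every $\varepsilon>0$ there is an $\varepsilon$-differentially private online synthetic data algorithm satisfying, for every data stream in $[0,1]^d$ and every time $t\ge 2$, $$\mathbb E\,W_1(\mu_{\mathcal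 X_t},\mu_{\mathcal Y_t})\le C_d\cdot\begin{cases}\varepsilon^{-1}\log(t)\,t^{-1/d}, & d\ge 2,\\ (\varepsilon t)^{-1}\log^{4.5}(t), & d=1.\end{cases}$$ -/

import Mathlib

open MeasureTheory
open scoped ENNReal

/-- The cube `[0,1]^d`. Its metric is the one of the product type, that is, the `ℓ∞` metric, and
its σ-algebra is the product Borel σ-algebra. -/
abbrev Cube (d : ℕ) : Type := Fin d → Set.Icc (0 : ℝ) 1

/-- An infinite data stream in `[0,1]^d`; `x i` is the point that arrives at time `i + 1`. -/
abbrev DataStream (d : ℕ) : Type := ℕ → Cube d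

/-- A dataset of `t` points of `[0,1]^d`. -/
abbrev Dataset (d t : ℕ) : Type := Fin t → Cube d

/-- The data available at time `t`: the first `t` points of the stream. -/
def DataStream.upTo {d : ℕ} (x : DataStream d) (t : ℕ) : Dataset d t := fun i => x i

/-- Two streams are neighbors if they differ in at most one coordinate. -/
def DataStream.Neighbors {d : ℕ} (x x' : DataStream d) : Prop :=
  ∃ i : ℕ, ∀ j : ℕ, j ≠ i → x j = x' j

/-- The empirical measure `t⁻¹ ∑ i, δ_{x i}` of a dataset of `t` points (used for `t ≥ 1`). -/
noncomputable def empiricalMeasure {d t : ℕ} (x : Dataset d t) : Measure (Cube d) :=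
  (t : ℝ≥0∞)⁻¹ • ∑ i : Fin t, Measure.dirac (x i)

/-- The `1`-Wasserstein distance: the infimum of the transport costs `∫ ρ(x,y) dγ(x,y)` over all
couplings `γ` of `μ` and `ν`. -/
noncomputable def wassersteinOne {X : Type*} [MetricSpace X] [MeasurableSpace X]
    (μ ν : Measure X) : ℝ≥0∞ :=
  ⨅ (γ : Measure (X × X)) (_ : γ.fst = μ) (_ : γ.snd = ν), ∫⁻ p, edist p.1 p.2 ∂γ

/-- An online synthetic data generation algorithm on `[0,1]^d` with infinite time horizon.
All its randomness is a point `ω` of a probability space. At each time `t` it sees only the first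
`t` data points and outputs `t` synthetic points; the same `ω` is used at all times, so the
outputs at different times may be correlated in any way. (At time `0` the output is the
empty dataset.) -/
structure OnlineAlgorithm (d : ℕ) where
  /-- The sample space of the internal randomness. -/
  Ω : Type
  [mΩ : MeasurableSpace Ω]
  /-- The law of the internal randomness. -/
  P : Measure Ω
  [prob : IsProbabilityMeasure P]
  /-- The synthetic dataset released at time `t`, given the first `t` data points. -/
  A : (t : ℕ) → Dataset d t → Ω → Dataset d t
  measurable_A : ∀ t : ℕ, Measurable (fun p : Dataset d t × Ω => A t p.1 p.2)

attribute [instance] OnlineAlgorithm.mΩ OnlineAlgorithm.prob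

namespace OnlineAlgorithm

/-- The whole sequence of synthetic datasets that is released on the stream `x`. -/
def output {d : ℕ} (M : OnlineAlgorithm d) (x : DataStream d) (ω : M.Ω) :
    (t : ℕ) → Dataset d t :=
  fun t => M.A t (x.upTo t) ω

/-- `ε`-differential privacy of the entire infinite sequence of outputs. -/
def IsDifferentiallyPrivate {d : ℕ} (M : OnlineAlgorithm d) (ε : ℝ) : Prop :=
  ∀ x x' : DataStream d, x.Neighbors x' →
    ∀ S : Set ((t : ℕ) → Dataset d t), MeasurableSet S →
      M.P {ω | M.output x ω ∈ S} ≤ ENNReal.ofReal (Real.exp ε) * M.P {ω | M.output x' ω ∈ S}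

/-- The expected `1`-Wasserstein distance between the empirical measures of the first `t` data
points and of the `t` synthetic points released at time `t`. -/
noncomputable def expectedError {d : ℕ} (M : OnlineAlgorithm d) (x : DataStream d) (t : ℕ) :
    ℝ≥0∞ :=
  ∫⁻ ω, wassersteinOne (empiricalMeasure (x.upTo t)) (empiricalMeasure (M.output x ω t)) ∂M.P

end OnlineAlgorithm

/-! Cut time into dyadic blocks `[q 2^k, (q+1) 2^k)` with `q ≥ 1`. In each block count the points in
every dyadic cell of side `2⁻ʲ`, `1 ≤ j ≤ J`, add independent discrete Laplace noise, and fit `2^k`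
grid points to the noisy counts. The times `1, …, t` split into at most two blocks of each size, and
the synthetic data of these blocks are concatenated. All outputs at all times are functions of one
infinite vector of noisy counts, so it suffices that this vector is private.

Privacy (`sum_rate_mul_natAbs_le`). Excluding `q = 0` is what permits an infinite horizon: time `s`
lies in just one block for each `k ≤ log₂ s`, and in no larger one. Within a block, changing a point
alters at most two counts per level, each by one. A block with right end `e` gets the budget `η = ε
/ (2 (log₂ e + 1))` for the sum of its rates; over the `log₂ s + 1` affected blocks, twice these
budgets add up to at most `ε`.

Accuracy. Distances are dominated by a tree metric (`dist_le_sum_cell_ne`), and a single matching is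
good at all levels of the tree at once (`exists_perm_card_ne_le`), so transport cost is controlled
by differences of cell counts. The data rounded to the grid compete in the fit, hence a block costs
at most its discretization error plus twice its weighted noise.

Rate. With suitable `J` and noise rates, a block costs `O(blockRate d k / η)`
(`exists_block_parameters`), that is `2^(k(1-1/d)) / η` for `d ≥ 2` and `(k+1)² / η` for `d = 1`.
Summing over the blocks and dividing by `t` gives the theorem, in dimension one even with `log⁴`.
Large `ε` needs care: the error must still fall like `1/ε`, so the grid is refined with `η`, and the
faster than `1/r` decay of discrete Laplace noise pays for the extra cells. -/

/-! ### Matchings optimal at every level of a tree -/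

theorem sum_eq_pair_add_sum_sdiff {α M : Type*} [Fintype α] [DecidableEq α] [AddCommMonoid M]
    (g : α → M) {a b : α} (hab : a ≠ b) :
    ∑ i, g i = g a + g b + ∑ i ∈ Finset.univ \ {a, b}, g i := by
  rw [← Finset.sum_pair hab, add_comm, Finset.sum_sdiff (Finset.subset_univ _)]

/-- Two families of points with the same index set can be matched in a way that is simultaneously
optimal at all levels of a refining sequence of labelings. -/
theorem exists_perm_card_ne_le {α E L : Type*} [Fintype α] [DecidableEq α] [DecidableEq L]
    (c : ℕ → E → L) (hc : ∀ i j, i ≤ j → ∀ x y, c j x = c j y → c i x = c i y)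
    (J : ℕ) (x y : α → E) :
    ∃ σ : Equiv.Perm α, ∀ j ∈ Finset.Icc 1 J, ∀ S : Finset L, (∀ a, c j (x a) ∈ S) →
      (Finset.univ.filter fun a => c j (x a) ≠ c j (y (σ a))).card ≤
        ∑ l ∈ S, Int.natAbs (((Finset.univ.filter fun a => c j (x a) = l).card : ℤ) -
          (Finset.univ.filter fun a => c j (y a) = l).card) := by
  let m : ℕ → α → α → ℕ := fun j a b => if c j (x a) = c j (y b) then 0 else 1
  -- Minimize the number of mismatched pairs summed over all levels; the refinement property makes
  -- this one minimizer good at each level separately.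
  let Φ : Equiv.Perm α → ℕ := fun σ => ∑ j ∈ Finset.Icc 1 J, ∑ a, m j a (σ a)
  obtain ⟨σ, hσ⟩ := Finite.exists_min Φ
  refine ⟨σ, fun j hj S hS => ?_⟩
  -- Otherwise exchanging the partners of `a` and `a'` would lower `Φ`. The gain is strict at level
  -- `j`. At coarser levels `y (σ a')` shares the label of `x a`, so nothing is lost; at finer
  -- levels both pairs are already mismatched.
  have key : ∀ a a', c j (x a) ≠ c j (y (σ a)) → c j (y (σ a')) = c j (x a) →
      c j (x a') = c j (x a) := by
    intro a a' h1 h2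
    by_contra h3
    have hne : a ≠ a' := fun h => h3 (by rw [h])
    have hlt : Φ ((Equiv.swap a a').trans σ) < Φ σ := by
      have ha : ((Equiv.swap a a').trans σ) a = σ a' := by simp
      have ha' : ((Equiv.swap a a').trans σ) a' = σ a := by simp
      have hrest : ∀ i, ∑ b ∈ Finset.univ \ {a, a'}, m i b (((Equiv.swap a a').trans σ) b) =
          ∑ b ∈ Finset.univ \ {a, a'}, m i b (σ b) := by
        intro i
        refine Finset.sum_congr rfl fun b hb => ?_
        simp only [Finset.mem_sdiff, Finset.mem_univ, Finset.mem_insert, Finset.mem_singleton,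
          true_and, not_or] at hb
        simp [Equiv.swap_apply_of_ne_of_ne hb.1 hb.2]
      refine Finset.sum_lt_sum (fun i _ => ?_) ⟨j, hj, ?_⟩
      · rw [sum_eq_pair_add_sum_sdiff _ hne, sum_eq_pair_add_sum_sdiff (fun b => m i b (σ b)) hne,
          hrest, ha, ha']
        refine Nat.add_le_add_right ?_ _
        simp only [m]
        rcases le_total i j with hij | hij
        · have e1 := hc i j hij _ _ h2
          rw [e1]
          by_cases h4 : c i (x a') = c i (x a) <;> by_cases h5 : c i (x a) = c i (y (σ a)) <;>
            simp [h4, h5] <;> split_ifs <;> omega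
        · have e1 : c i (x a) ≠ c i (y (σ a)) := fun h => h1 (hc j i hij _ _ h)
          have e2 : c i (x a') ≠ c i (y (σ a')) := fun h => h3 ((hc j i hij _ _ h).trans h2)
          simp only [e1, e2, if_false]
          split_ifs <;> omega
      · rw [sum_eq_pair_add_sum_sdiff _ hne, sum_eq_pair_add_sum_sdiff (fun b => m j b (σ b)) hne,
          hrest, ha, ha']
        refine Nat.add_lt_add_right ?_ _
        simp only [m]
        simp only [h1, h2, if_true, if_false]
        split_ifs <;> omega
    exact absurd (hσ _) (not_le.2 hlt)
  rw [Finset.card_eq_sum_card_fiberwise (f := fun a => c j (x a)) (t := S) (fun a _ => hS a)]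
  refine Finset.sum_le_sum fun l _ => ?_
  simp only [Finset.filter_filter]
  have hy : (Finset.univ.filter fun a => c j (y a) = l).card =
      (Finset.univ.filter fun a => c j (y (σ a)) = l).card := by
    symm
    refine Finset.card_bij (fun a _ => σ a) (by simp) (by simp) fun b hb => ?_
    exact ⟨σ.symm b, by simpa using hb, by simp⟩
  rw [hy]
  -- If some `x`-point with label `l` is mismatched, `key` says that every `y`-point with this label
  -- is matched inside it, so the mismatches number exactly the excess of `x`-points.
  by_cases hout : ∃ a, c j (x a) ≠ c j (y (σ a)) ∧ c j (x a) = l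
  · obtain ⟨a, ha1, ha2⟩ := hout
    have hsub : (Finset.univ.filter fun a => c j (y (σ a)) = l) ⊆
        (Finset.univ.filter fun a => c j (x a) = l) := by
      intro a' ha'
      simp only [Finset.mem_filter, Finset.mem_univ, true_and] at ha' ⊢
      rw [← ha2]
      exact key a a' ha1 (by rw [ha', ha2])
    have hcard : (Finset.univ.filter fun a => c j (x a) ≠ c j (y (σ a)) ∧ c j (x a) = l) =
        (Finset.univ.filter fun a => c j (x a) = l) \
          (Finset.univ.filter fun a => c j (y (σ a)) = l) := by
      ext b
      simp only [Finset.mem_filter, Finset.mem_univ, true_and, Finset.mem_sdiff]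
      constructor
      · rintro ⟨h1, h2⟩
        exact ⟨h2, fun h => h1 (h2.trans h.symm)⟩
      · rintro ⟨h1, h2⟩
        exact ⟨fun h => h2 (h ▸ h1), h1⟩
    rw [hcard, Finset.card_sdiff_of_subset hsub]
    omega
  · have : (Finset.univ.filter fun a => c j (x a) ≠ c j (y (σ a)) ∧ c j (x a) = l) = ∅ := by
      ext b
      simp only [Finset.mem_filter, Finset.mem_univ, true_and, Finset.notMem_empty, iff_false]
      exact fun h => hout ⟨b, h⟩
    rw [this]
    simp

/-! ### Likelihood ratios on infinite products -/

theorem measure_le_of_singleton_le {X : Type*} [Countable X] [MeasurableSpace X]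
    [MeasurableSingletonClass X] {μ ν : Measure X} {c : ℝ≥0∞}
    (h : ∀ x, μ {x} ≤ c * ν {x}) (S : Set X) : μ S ≤ c * ν S := by
  rw [← Measure.tsum_indicator_apply_singleton μ S S.to_countable.measurableSet,
    ← Measure.tsum_indicator_apply_singleton ν S S.to_countable.measurableSet,
    ← ENNReal.tsum_mul_left]
  refine ENNReal.tsum_le_tsum fun x => ?_
  by_cases hx : x ∈ S <;> simp [hx, h x]

/-- On a cylinder the ratio is a finite product of pointwise ratios, bounded by `C`; cylinders
approximate every measurable set. -/
theorem infinitePi_le_of_singleton_le {ι X : Type*} [Countable X] [MeasurableSpace X]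
    [MeasurableSingletonClass X] (μ ν : ι → Measure X) [∀ i, IsProbabilityMeasure (μ i)]
    [∀ i, IsProbabilityMeasure (ν i)] (c : ι → ℝ≥0∞) (C : ℝ≥0∞) (hC : C ≠ ∞)
    (h : ∀ i x, μ i {x} ≤ c i * ν i {x}) (hc : ∀ s : Finset ι, ∏ i ∈ s, c i ≤ C)
    {S : Set (ι → X)} (hS : MeasurableSet S) :
    Measure.infinitePi μ S ≤ C * Measure.infinitePi ν S := by
  set P := Measure.infinitePi μ
  set Q := Measure.infinitePi ν
  have hcyl : ∀ A ∈ measurableCylinders (fun _ : ι => X), P A ≤ C * Q A := by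
    intro A hA
    obtain ⟨s, B, hB, rfl⟩ := (mem_measurableCylinders A).1 hA
    simp only [P, Q]
    rw [Measure.infinitePi_cylinder μ hB, Measure.infinitePi_cylinder ν hB]
    refine measure_le_of_singleton_le (fun x => ?_) B
    rw [Measure.pi_singleton, Measure.pi_singleton]
    calc ∏ i : s, μ i {x i} ≤ ∏ i : s, (c i * ν i {x i}) :=
          Finset.prod_le_prod' fun i _ => h _ _
      _ = (∏ i : s, c i) * ∏ i : s, ν i {x i} := Finset.prod_mul_distrib
      _ ≤ C * ∏ i : s, ν i {x i} := by
          gcongr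
          rw [Finset.prod_coe_sort s c]
          exact hc s
  -- Density for `P + Q` yields one cylinder close to `S` under both measures.
  have hdense : (P + Q).MeasureDense (measurableCylinders (fun _ : ι => X)) :=
    Measure.MeasureDense.of_generateFrom_isSetAlgebra_finite _
      isSetAlgebra_measurableCylinders generateFrom_measurableCylinders.symm
  have happ : ∀ δ : ℝ, 0 < δ → P S ≤ C * Q S + (C + 1) * ENNReal.ofReal δ := by
    intro δ hδ
    obtain ⟨A, hA, hAS⟩ := hdense.approx S hS (measure_ne_top _ _) δ hδ
    rw [Measure.add_apply] at hAS
    have hP : P (symmDiff S A) ≤ ENNReal.ofReal δ := le_trans le_self_add hAS.le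
    have hQ : Q (symmDiff S A) ≤ ENNReal.ofReal δ := le_trans le_add_self hAS.le
    have h1 : P S ≤ P A + ENNReal.ofReal δ := by
      refine (measure_mono (?_ : S ⊆ A ∪ symmDiff S A)).trans
        ((measure_union_le _ _).trans (by gcongr))
      intro z hz
      by_cases hzA : z ∈ A
      · exact Or.inl hzA
      · exact Or.inr (Or.inl ⟨hz, hzA⟩)
    have h2 : Q A ≤ Q S + ENNReal.ofReal δ := by
      refine (measure_mono (?_ : A ⊆ S ∪ symmDiff S A)).trans
        ((measure_union_le _ _).trans (by gcongr))
      intro z hz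
      by_cases hzS : z ∈ S
      · exact Or.inl hzS
      · exact Or.inr (Or.inr ⟨hz, hzS⟩)
    calc P S ≤ P A + ENNReal.ofReal δ := h1
      _ ≤ C * (Q S + ENNReal.ofReal δ) + ENNReal.ofReal δ := by
          gcongr
          exact (hcyl A hA).trans (by gcongr)
      _ = C * Q S + (C + 1) * ENNReal.ofReal δ := by ring
  have hlim : Filter.Tendsto (fun δ : ℝ => C * Q S + (C + 1) * ENNReal.ofReal δ)
      (nhdsWithin 0 (Set.Ioi 0)) (nhds (C * Q S + (C + 1) * ENNReal.ofReal 0)) := by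
    refine Filter.Tendsto.mono_left ?_ nhdsWithin_le_nhds
    refine Filter.Tendsto.add tendsto_const_nhds ?_
    refine ENNReal.Tendsto.const_mul (ENNReal.continuous_ofReal.tendsto 0) (Or.inr ?_)
    simp [hC]
  have := ge_of_tendsto hlim (Filter.eventually_of_mem self_mem_nhdsWithin fun δ hδ => happ δ hδ)
  simpa using this

/-! ### Discrete Laplace noise -/

/-- The unnormalized weights of the discrete Laplace distribution sum to `(1 + q) / (1 - q)`. -/
theorem hasSum_pow_natAbs {q : ℝ} (h0 : 0 ≤ q) (h1 : q < 1) :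
    HasSum (fun n : ℤ => q ^ n.natAbs) ((1 + q) / (1 - q)) := by
  have hq : 1 - q ≠ 0 := by linarith
  have e1 : HasSum (fun n : ℕ => q ^ ((n : ℤ)).natAbs) (1 - q)⁻¹ := by
    simpa using hasSum_geometric_of_lt_one h0 h1
  have e2 : HasSum (fun n : ℕ => q ^ (-(n + 1 : ℤ)).natAbs) (q * (1 - q)⁻¹) := by
    have : (fun n : ℕ => q ^ (-(n + 1 : ℤ)).natAbs) = fun n : ℕ => q * q ^ n := by
      funext n
      have : (-(n + 1 : ℤ)).natAbs = n + 1 := by omega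
      rw [this, pow_succ']
    rw [this]
    exact (hasSum_geometric_of_lt_one h0 h1).mul_left q
  have e3 := HasSum.of_nat_of_neg_add_one (f := fun n : ℤ => q ^ n.natAbs) e1 e2
  have e4 : (1 - q)⁻¹ + q * (1 - q)⁻¹ = (1 + q) / (1 - q) := by ring
  rwa [e4] at e3

theorem hasSum_natAbs_mul_pow_natAbs {q : ℝ} (h0 : 0 ≤ q) (h1 : q < 1) :
    HasSum (fun n : ℤ => (n.natAbs : ℝ) * q ^ n.natAbs) (2 * q / (1 - q) ^ 2) := by
  have hq : 1 - q ≠ 0 := by linarith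
  have hn : ‖q‖ < 1 := by rwa [Real.norm_of_nonneg h0]
  have e0 := hasSum_coe_mul_geometric_of_norm_lt_one hn
  have e1 : HasSum (fun n : ℕ => (((n : ℤ)).natAbs : ℝ) * q ^ ((n : ℤ)).natAbs)
      (q / (1 - q) ^ 2) := by simpa using e0
  have e2 : HasSum (fun n : ℕ => ((-(n + 1 : ℤ)).natAbs : ℝ) * q ^ (-(n + 1 : ℤ)).natAbs)
      (q / (1 - q) ^ 2) := by
    have : (fun n : ℕ => ((-(n + 1 : ℤ)).natAbs : ℝ) * q ^ (-(n + 1 : ℤ)).natAbs) =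
        fun n : ℕ => (fun m : ℕ => (m : ℝ) * q ^ m) (n + 1) := by
      funext n
      have : (-(n + 1 : ℤ)).natAbs = n + 1 := by omega
      simp only [this]
    rw [this, hasSum_nat_add_iff (f := fun m : ℕ => (m : ℝ) * q ^ m)]
    simpa using e0
  have e3 := HasSum.of_nat_of_neg_add_one (f := fun n : ℤ => (n.natAbs : ℝ) * q ^ n.natAbs) e1 e2
  have e4 : q / (1 - q) ^ 2 + q / (1 - q) ^ 2 = 2 * q / (1 - q) ^ 2 := by ring
  rwa [e4] at e3

/-- The probability mass function of the discrete Laplace distribution with parameter `q`. -/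
noncomputable def discreteLaplacePMF (q : ℝ) (h0 : 0 ≤ q) (h1 : q < 1) : PMF ℤ :=
  ⟨fun n => ENNReal.ofReal ((1 - q) / (1 + q) * q ^ n.natAbs), by
    have h := (hasSum_pow_natAbs h0 h1).mul_left ((1 - q) / (1 + q))
    have e : (1 - q) / (1 + q) * ((1 + q) / (1 - q)) = 1 := by
      have : 1 - q ≠ 0 := by linarith
      have : 1 + q ≠ 0 := by linarith
      field_simp
    rw [e] at h
    have hpos : ∀ n : ℤ, 0 ≤ (1 - q) / (1 + q) * q ^ n.natAbs := fun n =>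
      mul_nonneg (div_nonneg (by linarith) (by linarith)) (pow_nonneg h0 _)
    have := ENNReal.ofReal_tsum_of_nonneg hpos h.summable
    rw [h.tsum_eq, ENNReal.ofReal_one] at this
    rw [this]
    exact ENNReal.summable.hasSum⟩

/-- The discrete Laplace distribution on `ℤ` with weights proportional to `exp (-r |n|)`. -/
noncomputable def discreteLaplace (r : {r : ℝ // 0 < r}) : Measure ℤ :=
  (discreteLaplacePMF (Real.exp (-r)) (Real.exp_pos _).le
    (by simpa using r.2)).toMeasure

instance (r : {r : ℝ // 0 < r}) : IsProbabilityMeasure (discreteLaplace r) := by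
  unfold discreteLaplace; infer_instance

theorem discreteLaplace_singleton (r : {r : ℝ // 0 < r}) (n : ℤ) :
    discreteLaplace r {n} = ENNReal.ofReal
      ((1 - Real.exp (-r)) / (1 + Real.exp (-r)) * Real.exp (-r) ^ n.natAbs) := by
  rw [discreteLaplace, PMF.toMeasure_apply_singleton _ _ (MeasurableSet.singleton n)]
  rfl

theorem discreteLaplace_singleton_le (r : {r : ℝ // 0 < r}) (m n : ℤ) :
    discreteLaplace r {m} ≤
      ENNReal.ofReal (Real.exp (r * (m - n).natAbs)) * discreteLaplace r {n} := by
  rw [discreteLaplace_singleton, discreteLaplace_singleton,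
    ← ENNReal.ofReal_mul (Real.exp_pos _).le]
  refine ENNReal.ofReal_le_ofReal ?_
  have h1 : Real.exp (-r) < 1 := by simpa using r.2
  have h2 : 0 ≤ (1 - Real.exp (-r)) / (1 + Real.exp (-r)) :=
    div_nonneg (by linarith) (by positivity)
  rw [mul_left_comm]
  refine mul_le_mul_of_nonneg_left ?_ h2
  rw [← Real.exp_nat_mul, ← Real.exp_nat_mul, ← Real.exp_add, Real.exp_le_exp]
  have h3 : (n.natAbs : ℝ) ≤ m.natAbs + (m - n).natAbs := by
    have : n.natAbs ≤ m.natAbs + (m - n).natAbs := by omega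
    exact_mod_cast this
  nlinarith [r.2]

theorem lintegral_natAbs_discreteLaplace_le (r : {r : ℝ // 0 < r}) :
    ∫⁻ n, ENNReal.ofReal (n.natAbs : ℝ) ∂discreteLaplace r ≤
      ENNReal.ofReal (2 / (Real.exp r - 1)) := by
  rw [lintegral_countable']
  set q := Real.exp (-r) with hq
  have h0 : 0 < q := Real.exp_pos _
  have h1 : q < 1 := by simpa [hq] using r.2
  have hs := (hasSum_natAbs_mul_pow_natAbs h0.le h1).mul_left ((1 - q) / (1 + q))
  have hpos : ∀ n : ℤ, 0 ≤ (1 - q) / (1 + q) * ((n.natAbs : ℝ) * q ^ n.natAbs) := fun n =>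
    mul_nonneg (div_nonneg (by linarith) (by linarith)) (by positivity)
  have hterm : ∀ n : ℤ, ENNReal.ofReal (n.natAbs : ℝ) * discreteLaplace r {n} =
      ENNReal.ofReal ((1 - q) / (1 + q) * ((n.natAbs : ℝ) * q ^ n.natAbs)) := by
    intro n
    rw [discreteLaplace_singleton, ← ENNReal.ofReal_mul (by positivity)]
    congr 1
    ring
  simp_rw [hterm]
  rw [← ENNReal.ofReal_tsum_of_nonneg hpos hs.summable, hs.tsum_eq]
  refine ENNReal.ofReal_le_ofReal ?_
  have hr : Real.exp r = q⁻¹ := by rw [hq, Real.exp_neg, inv_inv]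
  have hlt : 0 < 1 - q := by linarith
  have : 2 / (Real.exp r - 1) = 2 * q / (1 - q) := by
    rw [hr]
    field_simp
  rw [this]
  have : (1 - q) / (1 + q) * (2 * q / (1 - q) ^ 2) = 2 * q / (1 - q) / (1 + q) := by
    field_simp
  rw [this]
  exact div_le_self (by positivity) (by linarith)

/-- Keep the terms of order `0` and `m` in the exponential series. The choice `m = 1` is the usual
bound; larger `m` exploits the decay of the noise for large rates. -/
theorem exp_sub_one_inv_le {x : ℝ} (hx : 0 < x) {m : ℕ} (hm : 1 ≤ m) :
    1 / (Real.exp x - 1) ≤ m.factorial / x ^ m := by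
  have h1 : 1 + x ^ m / m.factorial ≤ Real.exp x := by
    refine le_trans ?_ (Real.sum_le_exp_of_nonneg hx.le (m + 1))
    rw [Finset.sum_range_succ]
    gcongr
    have : ∑ i ∈ Finset.range 1, x ^ i / (i.factorial : ℝ) ≤
        ∑ i ∈ Finset.range m, x ^ i / (i.factorial : ℝ) :=
      Finset.sum_le_sum_of_subset_of_nonneg (Finset.range_mono hm) fun i _ _ => by positivity
    simpa using this
  have h2 : 0 < x ^ m / m.factorial := by positivity
  calc 1 / (Real.exp x - 1) ≤ 1 / (x ^ m / m.factorial) :=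
        one_div_le_one_div_of_le h2 (by linarith)
    _ = m.factorial / x ^ m := one_div_div _ _

/-- Independent discrete Laplace noise hides a shift by `u - v` up to a factor `exp ε` as soon as
`∑ r i * |u i - v i| ≤ ε`. -/
theorem infinitePi_discreteLaplace_shift_le {ι : Type*} (r : ι → {r : ℝ // 0 < r})
    (u v : ι → ℤ) (ε : ℝ) (h : ∀ s : Finset ι, ∑ i ∈ s, (r i : ℝ) * (u i - v i).natAbs ≤ ε)
    {T : Set (ι → ℤ)} (hT : MeasurableSet T) :
    Measure.infinitePi (fun i => discreteLaplace (r i)) {ω | (fun i => u i + ω i) ∈ T} ≤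
      ENNReal.ofReal (Real.exp ε) *
        Measure.infinitePi (fun i => discreteLaplace (r i)) {ω | (fun i => v i + ω i) ∈ T} := by
  have hmap : ∀ w : ι → ℤ, Measure.infinitePi (fun i => discreteLaplace (r i))
      {ω | (fun i => w i + ω i) ∈ T} =
      Measure.infinitePi (fun i => (discreteLaplace (r i)).map (fun n => w i + n)) T := by
    intro w
    rw [← Measure.infinitePi_map_pi (μ := fun i => discreteLaplace (r i))
      (f := fun i n => w i + n) (fun i => measurable_of_countable _),
      Measure.map_apply (by fun_prop) hT]
    rfl
  have : ∀ (w : ι → ℤ) i, IsProbabilityMeasure ((discreteLaplace (r i)).map (fun n => w i + n)) :=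
    fun w i => Measure.isProbabilityMeasure_map (measurable_of_countable _).aemeasurable
  rw [hmap u, hmap v]
  refine infinitePi_le_of_singleton_le _ _
    (fun i => ENNReal.ofReal (Real.exp (r i * (u i - v i).natAbs))) _ ENNReal.ofReal_ne_top
    (fun i x => ?_) (fun s => ?_) hT
  · have hsing : ∀ w : ι → ℤ, (discreteLaplace (r i)).map (fun n => w i + n) {x} =
        discreteLaplace (r i) {x - w i} := by
      intro w
      rw [Measure.map_apply (measurable_of_countable _) (MeasurableSet.singleton x)]
      congr 1
      ext n
      simp only [Set.mem_preimage, Set.mem_singleton_iff]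
      omega
    rw [hsing, hsing]
    have := discreteLaplace_singleton_le (r i) (x - u i) (x - v i)
    have e : (x - u i - (x - v i)).natAbs = (u i - v i).natAbs := by omega
    rwa [e] at this
  · rw [← ENNReal.ofReal_prod_of_nonneg fun i _ => (Real.exp_pos _).le, ← Real.exp_sum]
    exact ENNReal.ofReal_le_ofReal (Real.exp_le_exp.2 (h s))

/-! ### Choice of depth and noise rates in a block -/

/-- The order of the total transport cost of the mechanism on a block of `2 ^ k` points, for
privacy parameter `1`. -/
noncomputable def blockRate (d k : ℕ) : ℝ :=
  if 2 ≤ d then (2 : ℝ) ^ ((k : ℝ) * (1 - 1 / (d : ℝ))) else ((k : ℝ) + 1) ^ 2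

theorem blockRate_nonneg (d k : ℕ) : 0 ≤ blockRate d k := by
  unfold blockRate; split_ifs <;> positivity

theorem add_one_pow_three_le (p : ℕ) : (p + 1) ^ 3 ≤ 8 * 2 ^ p := by
  rcases lt_or_ge p 3 with h | h
  · interval_cases p <;> norm_num
  · induction p, h using Nat.le_induction with
    | base => norm_num
    | succ n hn ih =>
      have : (n + 1 + 1) ^ 3 ≤ 2 * (n + 1) ^ 3 := by nlinarith [mul_le_mul hn hn (by omega) (by omega)]
      rw [pow_succ 2 n]
      omega

theorem exists_two_pow_near (η : ℝ) :
    ∃ p : ℕ, (2 : ℝ) ^ p ≤ max 1 η ∧ max 1 η < 2 ^ (p + 1) :=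
  exists_nat_pow_near (le_max_left 1 η) one_lt_two

/-- In dimension one the weight `2⁻ʲ` cancels the number of cells, so all levels contribute alike
and the budget is split evenly. -/
theorem exists_block_parameters_one :
    ∃ C : ℝ, 0 < C ∧ ∀ (k : ℕ) (η : ℝ), 0 < η → ∃ (J : ℕ) (r : ℕ → {r : ℝ // 0 < r}),
      ∑ j ∈ Finset.Icc 1 J, (r j : ℝ) ≤ η ∧
      (2 : ℝ) ^ k / 2 ^ J + ∑ j ∈ Finset.Icc 1 J,
        2 / 2 ^ j * ((2 : ℝ) ^ j + 1) * (1 / (Real.exp (r j) - 1)) ≤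
          C * ((k : ℝ) + 1) ^ 2 / η := by
  refine ⟨513, by norm_num, fun k η hη => ?_⟩
  obtain ⟨p, hp1, hp2⟩ := exists_two_pow_near η
  -- The last `p + 1` levels bring the mesh below `1/η`, for large `η`.
  set J := k + 1 + (p + 1) with hJ
  have hJpos : (0 : ℝ) < J := by rw [hJ]; positivity
  refine ⟨J, fun _ => ⟨η / J, by positivity⟩, ?_, ?_⟩
  · simp only [Finset.sum_const, Nat.card_Icc, Nat.add_sub_cancel, nsmul_eq_mul]
    rw [mul_div_cancel₀ _ hJpos.ne']
  have hk1 : (1 : ℝ) ≤ ((k : ℝ) + 1) ^ 2 := one_le_pow₀ (by linarith [Nat.cast_nonneg (α := ℝ) k])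
  have hdisc : (2 : ℝ) ^ k / 2 ^ J ≤ ((k : ℝ) + 1) ^ 2 / η := by
    have e : (2 : ℝ) ^ J = 2 ^ k * (2 * 2 ^ (p + 1)) := by rw [hJ]; ring
    rw [e, div_le_div_iff₀ (by positivity) hη]
    have h1 : η ≤ 2 ^ (p + 1) := (le_max_right 1 η).trans hp2.le
    have h2 : (0 : ℝ) < 2 ^ k := by positivity
    calc (2 : ℝ) ^ k * η ≤ 2 ^ k * (2 * 2 ^ (p + 1)) := by
          gcongr; linarith [pow_pos (zero_lt_two' ℝ) (p + 1)]
      _ ≤ ((k : ℝ) + 1) ^ 2 * (2 ^ k * (2 * 2 ^ (p + 1))) :=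
          le_mul_of_one_le_left (by positivity) hk1
  have hmain : J * (1 / (Real.exp (η / J) - 1)) ≤ 128 * ((k : ℝ) + 1) ^ 2 / η := by
    have hx : 0 < η / J := by positivity
    -- If `p ≤ k`, then `J = O(k + 1)` and the linear bound gives `J² / η`. Otherwise `η` is large
    -- and `J = O(p + 1)`; the quadratic bound gives `J³ / η²`, where `J³ = O(2^p) = O(η)`.
    rcases le_or_gt p k with hpk | hpk
    · have h1 := exp_sub_one_inv_le hx (m := 1) le_rfl
      have h2 : (J : ℝ) ≤ 2 * (k + 1) := by
        have : J ≤ 2 * (k + 1) := by omega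
        exact_mod_cast this
      calc J * (1 / (Real.exp (η / J) - 1)) ≤ J * ((1 : ℕ).factorial / (η / J) ^ 1) := by gcongr
        _ = J ^ 2 / η := by simp; field_simp
        _ ≤ (2 * (k + 1)) ^ 2 / η := by gcongr
        _ ≤ 128 * ((k : ℝ) + 1) ^ 2 / η := by gcongr; nlinarith
    · have h1 := exp_sub_one_inv_le hx (m := 2) one_le_two
      have h2 : (J : ℝ) ≤ 2 * (p + 1) := by
        have : J ≤ 2 * (p + 1) := by omega
        exact_mod_cast this
      have hη1 : max 1 η = η := by
        refine max_eq_right ?_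
        by_contra h
        rw [max_eq_left (not_le.1 h).le] at hp1
        have : (1 : ℝ) < 2 ^ p := one_lt_pow₀ one_lt_two (by omega)
        linarith
      rw [hη1] at hp1
      have h3 : ((p : ℝ) + 1) ^ 3 ≤ 8 * 2 ^ p := by exact_mod_cast add_one_pow_three_le p
      calc J * (1 / (Real.exp (η / J) - 1)) ≤ J * ((2 : ℕ).factorial / (η / J) ^ 2) := by gcongr
        _ = 2 * J ^ 3 / η ^ 2 := by simp [Nat.factorial]; field_simp
        _ ≤ 2 * (2 * (p + 1)) ^ 3 / η ^ 2 := by gcongr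
        _ ≤ 128 * η / η ^ 2 := by
            refine div_le_div_of_nonneg_right ?_ (by positivity)
            nlinarith
        _ = 128 / η := by field_simp
        _ ≤ 128 * ((k : ℝ) + 1) ^ 2 / η := by gcongr; nlinarith
  have hpos : 0 < 1 / (Real.exp (η / J) - 1) := by
    have : 1 < Real.exp (η / J) := by simpa using (by positivity : 0 < η / J)
    exact one_div_pos.2 (by linarith)
  have hsum : ∑ j ∈ Finset.Icc 1 J, 2 / 2 ^ j * ((2 : ℝ) ^ j + 1) *
      (1 / (Real.exp (η / J) - 1)) ≤ 4 * (J * (1 / (Real.exp (η / J) - 1))) := by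
    calc _ ≤ ∑ j ∈ Finset.Icc 1 J, 4 * (1 / (Real.exp (η / J) - 1)) := by
          refine Finset.sum_le_sum fun j _ => ?_
          refine mul_le_mul_of_nonneg_right ?_ hpos.le
          rw [div_mul_eq_mul_div, div_le_iff₀ (by positivity)]
          have : (1 : ℝ) ≤ 2 ^ j := one_le_pow₀ one_le_two
          linarith
      _ = _ := by simp; ring
  calc _ ≤ ((k : ℝ) + 1) ^ 2 / η + 4 * (128 * ((k : ℝ) + 1) ^ 2 / η) := by
        refine add_le_add hdisc (hsum.trans (by gcongr))
    _ = 513 * ((k : ℝ) + 1) ^ 2 / η := by ring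

/-- Order `1` of the series serves `η ≤ 1` and order `d` serves `η > 1`. The factor `max 1 η ^ (d -
1)` offsets the growth in the number of cells when the grid is refined with `η`. -/
theorem exp_sub_one_inv_le_max {d : ℕ} (hd : 1 ≤ d) {η c : ℝ} (hη : 0 < η) (hc : 1 ≤ c) :
    1 / (Real.exp (η / c) - 1) ≤ d.factorial * c ^ d / (η * (max 1 η) ^ (d - 1)) := by
  have hx : 0 < η / c := by positivity
  rcases le_or_gt η 1 with h | h
  · rw [max_eq_left h, one_pow, mul_one]
    refine (exp_sub_one_inv_le hx (m := 1) le_rfl).trans ?_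
    have h1 : (1 : ℝ) ≤ d.factorial := by exact_mod_cast Nat.one_le_iff_ne_zero.2 d.factorial_ne_zero
    have h2 : c ≤ c ^ d := le_self_pow₀ hc (by omega)
    have e : ((1 : ℕ).factorial : ℝ) / (η / c) ^ 1 = c / η := by simp
    rw [e]
    gcongr
    nlinarith
  · rw [max_eq_right h.le]
    refine (exp_sub_one_inv_le hx hd).trans (le_of_eq ?_)
    obtain ⟨n, rfl⟩ : ∃ n, d = n + 1 := ⟨d - 1, by omega⟩
    rw [Nat.add_sub_cancel, ← pow_succ', div_pow]
    field_simp

/-- Ratio of the error bounds of consecutive levels, towards the coarse end: rates shrink by `3/4`,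
costing `(4/3)^d`, while cell number times side shrinks by `2^(d-1)`. Being below `1`, it makes the
finest level dominate; `d = 2` is the extreme case. -/
theorem four_thirds_pow_le {d : ℕ} (hd : 2 ≤ d) : ((4 : ℝ) / 3) ^ d / 2 ^ (d - 1) ≤ 8 / 9 := by
  induction d, hd using Nat.le_induction with
  | base => norm_num
  | succ n hn ih =>
    obtain ⟨m, rfl⟩ : ∃ m, n = m + 1 := ⟨n - 1, by omega⟩
    simp only [Nat.add_sub_cancel] at ih ⊢
    rw [pow_succ ((4 : ℝ) / 3) (m + 1), pow_succ (2 : ℝ) m]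
    rw [div_le_iff₀ (by positivity)] at ih ⊢
    nlinarith [pow_pos (zero_lt_two' ℝ) m]

theorem sum_Icc_pow_sub_le {x b : ℝ} (h0 : 0 ≤ x) (h1 : x < 1) (hb : (1 - x)⁻¹ = b) (J : ℕ) :
    ∑ j ∈ Finset.Icc 1 J, x ^ (J - j) ≤ b := by
  have e : ∑ j ∈ Finset.Icc 1 J, x ^ (J - j) = ∑ i ∈ Finset.range J, x ^ i := by
    refine Finset.sum_nbij' (fun j => J - j) (fun i => J - i) ?_ ?_ ?_ ?_ (fun _ _ => rfl) <;>
      simp only [Finset.mem_Icc, Finset.mem_range] <;> intros <;> omega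
  rw [e, ← hb]
  rw [← tsum_geometric_of_lt_one h0 h1]
  exact (summable_geometric_of_lt_one h0 h1).sum_le_tsum _ fun i _ => pow_nonneg h0 i

theorem exists_block_parameters_of_two_le {d : ℕ} (hd : 2 ≤ d) :
    ∃ C : ℝ, 0 < C ∧ ∀ (k : ℕ) (η : ℝ), 0 < η → ∃ (J : ℕ) (r : ℕ → {r : ℝ // 0 < r}),
      ∑ j ∈ Finset.Icc 1 J, (r j : ℝ) ≤ η ∧
      (2 : ℝ) ^ k / 2 ^ J + ∑ j ∈ Finset.Icc 1 J,
        2 / 2 ^ j * ((2 : ℝ) ^ j + 1) ^ d * (1 / (Real.exp (r j) - 1)) ≤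
          C * (2 : ℝ) ^ ((k : ℝ) * (1 - 1 / (d : ℝ))) / η := by
  set A : ℝ := 2 * 2 ^ d * (d.factorial * 4 ^ d) with hA
  have hApos : 0 < A := by positivity
  refine ⟨1 + A * 9 * 4 ^ (d - 1), by positivity, fun k η hη => ?_⟩
  obtain ⟨p, hp1, hp2⟩ := exists_two_pow_near η
  set M := max 1 η with hM
  have hM1 : 1 ≤ M := le_max_left _ _
  have hMη : η ≤ M := le_max_right _ _
  have hd0 : (0 : ℝ) < d := by positivity
  set φ := (2 : ℝ) ^ ((k : ℝ) * (1 - 1 / (d : ℝ))) with hφ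
  set B := (2 : ℝ) ^ ((k : ℝ) / d) with hB
  have hφpos : 0 < φ := by positivity
  have hBpos : 0 < B := by positivity
  have hBφ : B * φ = 2 ^ k := by
    rw [hB, hφ, ← Real.rpow_add two_pos, ← Real.rpow_natCast]
    congr 1
    field_simp
    ring
  have hBd : B ^ d = 2 ^ k := by
    rw [hB, ← Real.rpow_natCast, ← Real.rpow_mul two_pos.le, ← Real.rpow_natCast 2 k]
    congr 1
    field_simp
  have hBd1 : B ^ (d - 1) = φ := by
    have : B * B ^ (d - 1) = B * φ := by
      rw [hBφ, ← hBd, ← pow_succ']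
      congr 1
      omega
    exact mul_left_cancel₀ hBpos.ne' this
  have hB1 : B ≤ 2 ^ (k / d + 1) := by
    rw [hB, ← Real.rpow_natCast]
    refine Real.rpow_le_rpow_of_exponent_le one_le_two ?_
    rw [div_le_iff₀ hd0]
    have : k ≤ (k / d + 1) * d := by
      have := Nat.lt_div_mul_add (a := k) (b := d) (by omega)
      nlinarith
    exact_mod_cast this
  have hB2 : (2 : ℝ) ^ (k / d + 1) ≤ 2 * B := by
    rw [pow_succ', hB, ← Real.rpow_natCast]
    gcongr
    · exact one_le_two
    · exact Nat.cast_div_le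
  -- Thus `2^J` is comparable to `2^(k/d) * max 1 η`: about one cell per point, refined by the
  -- factor `η` when `η > 1`.
  set J := k / d + 1 + (p + 1) with hJ
  have hG1 : B * M ≤ 2 ^ J := by
    rw [hJ, pow_add]
    exact mul_le_mul hB1 hp2.le (by positivity) (by positivity)
  have hG2 : (2 : ℝ) ^ J ≤ 4 * B * M := by
    rw [hJ, pow_add, pow_succ 2 p]
    calc (2 : ℝ) ^ (k / d + 1) * (2 ^ p * 2) ≤ (2 * B) * (M * 2) := by gcongr
      _ = 4 * B * M := by ring
  -- Most of the budget goes to the fine levels, which have the most cells; the `4` is the sum of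
  -- the geometric series of ratio `3/4`.
  refine ⟨J, fun j => ⟨η / (4 * (4 / 3) ^ (J - j)), by positivity⟩, ?_, ?_⟩
  · have e : ∀ j, η / (4 * (4 / 3 : ℝ) ^ (J - j)) = η / 4 * (3 / 4) ^ (J - j) := by
      intro j
      rw [show (4 / 3 : ℝ) = (3 / 4)⁻¹ by norm_num, inv_pow]
      field_simp
    simp only [e]
    rw [← Finset.mul_sum]
    have := sum_Icc_pow_sub_le (x := 3 / 4) (b := 4) (by norm_num) (by norm_num) (by norm_num) J
    nlinarith
  have hdisc : (2 : ℝ) ^ k / 2 ^ J ≤ φ / η := by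
    rw [div_le_div_iff₀ (by positivity) hη, ← hBφ]
    calc B * φ * η ≤ B * φ * M := by gcongr
      _ = φ * (B * M) := by ring
      _ ≤ φ * 2 ^ J := by gcongr
  have hterm : ∀ j ∈ Finset.Icc 1 J, 2 / 2 ^ j * ((2 : ℝ) ^ j + 1) ^ d *
      (1 / (Real.exp (η / (4 * (4 / 3) ^ (J - j))) - 1)) ≤
      A * 4 ^ (d - 1) * φ / η * (8 / 9) ^ (J - j) := by
    intro j hj
    have hjJ : j ≤ J := (Finset.mem_Icc.1 hj).2
    set i := J - j with hi
    have hc1 : (1 : ℝ) ≤ 4 * (4 / 3) ^ i := by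
      have : (1 : ℝ) ≤ (4 / 3) ^ i := one_le_pow₀ (by norm_num)
      linarith
    have h1 := exp_sub_one_inv_le_max (d := d) (by omega) hη hc1
    rw [← hM] at h1
    have h2j : (1 : ℝ) ≤ 2 ^ j := one_le_pow₀ one_le_two
    have h2 : 2 / 2 ^ j * ((2 : ℝ) ^ j + 1) ^ d ≤ 2 * 2 ^ d * (2 ^ j) ^ (d - 1) := by
      calc 2 / 2 ^ j * ((2 : ℝ) ^ j + 1) ^ d ≤ 2 / 2 ^ j * (2 * 2 ^ j) ^ d := by
            gcongr; linarith
        _ = 2 * 2 ^ d * (2 ^ j) ^ (d - 1) := by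
            obtain ⟨n, rfl⟩ : ∃ n, d = n + 1 := ⟨d - 1, by omega⟩
            rw [Nat.add_sub_cancel, mul_pow, pow_succ ((2 : ℝ) ^ j) n]
            field_simp
    have h3 : (2 : ℝ) ^ j = 2 ^ J / 2 ^ i := by
      rw [eq_div_iff (by positivity), ← pow_add]
      congr 1
      omega
    have h4 : ((2 : ℝ) ^ j) ^ (d - 1) * ((4 / 3) ^ i) ^ d ≤
        (4 * B * M) ^ (d - 1) * (8 / 9) ^ i := by
      calc ((2 : ℝ) ^ j) ^ (d - 1) * ((4 / 3) ^ i) ^ d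
          = (2 ^ J) ^ (d - 1) * (((4 : ℝ) / 3) ^ d / 2 ^ (d - 1)) ^ i := by
            rw [h3, div_pow ((2 : ℝ) ^ J), div_pow (((4 : ℝ) / 3) ^ d), ← pow_mul (4 / 3 : ℝ),
              ← pow_mul (4 / 3 : ℝ), ← pow_mul (2 : ℝ) i, ← pow_mul (2 : ℝ) (d - 1), mul_comm i d, mul_comm i (d - 1)]
            ring
        _ ≤ _ := mul_le_mul (pow_le_pow_left₀ (by positivity) hG2 _)
            (pow_le_pow_left₀ (by positivity) (four_thirds_pow_le hd) _)
            (by positivity) (by positivity)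
    have hexp : 0 ≤ 1 / (Real.exp (η / (4 * (4 / 3) ^ i)) - 1) := by
      have : 1 < Real.exp (η / (4 * (4 / 3) ^ i)) := by
        simpa using (by positivity : 0 < η / (4 * (4 / 3) ^ i))
      exact (one_div_pos.2 (by linarith)).le
    calc _ ≤ 2 * 2 ^ d * (2 ^ j) ^ (d - 1) *
          (d.factorial * (4 * (4 / 3) ^ i) ^ d / (η * M ^ (d - 1))) := by
          refine mul_le_mul h2 h1 hexp (by positivity)
      _ = A / (η * M ^ (d - 1)) * (((2 : ℝ) ^ j) ^ (d - 1) * ((4 / 3) ^ i) ^ d) := by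
          rw [hA, mul_pow]; ring
      _ ≤ A / (η * M ^ (d - 1)) * ((4 * B * M) ^ (d - 1) * (8 / 9) ^ i) := by gcongr
      _ = A * 4 ^ (d - 1) * φ / η * (8 / 9) ^ i := by
          rw [mul_pow, mul_pow, hBd1]
          field_simp
  calc _ ≤ φ / η + ∑ j ∈ Finset.Icc 1 J, A * 4 ^ (d - 1) * φ / η * (8 / 9) ^ (J - j) :=
        add_le_add hdisc (Finset.sum_le_sum hterm)
    _ ≤ φ / η + A * 4 ^ (d - 1) * φ / η * 9 := by
        rw [← Finset.mul_sum]
        gcongr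
        exact sum_Icc_pow_sub_le (by norm_num) (by norm_num) (by norm_num) J
    _ = (1 + A * 9 * 4 ^ (d - 1)) * φ / η := by ring

/-- Number of levels and noise rates for a block of `2 ^ k` points and privacy parameter `η`. -/
theorem exists_block_parameters {d : ℕ} (hd : 1 ≤ d) :
    ∃ C : ℝ, 0 < C ∧ ∀ (k : ℕ) (η : ℝ), 0 < η → ∃ (J : ℕ) (r : ℕ → {r : ℝ // 0 < r}),
      ∑ j ∈ Finset.Icc 1 J, (r j : ℝ) ≤ η ∧
      (2 : ℝ) ^ k / 2 ^ J + ∑ j ∈ Finset.Icc 1 J,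
        2 / 2 ^ j * ((2 : ℝ) ^ j + 1) ^ d * (1 / (Real.exp (r j) - 1)) ≤
          C * blockRate d k / η := by
  rcases hd.lt_or_eq with h | rfl
  · simpa only [blockRate, if_pos (show 2 ≤ d from h)] using exists_block_parameters_of_two_le h
  · simpa only [blockRate, show ¬ 2 ≤ 1 by norm_num, if_false, pow_one] using
      exists_block_parameters_one

/-! ### Dyadic cells and the tree metric -/

/-- The label of the dyadic cell of side `2⁻ʲ` that contains `x`. -/
noncomputable def cell {d : ℕ} (j : ℕ) (x : Cube d) : Fin d → ℕ := fun l => ⌊2 ^ j * (x l : ℝ)⌋₊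

theorem measurable_cell {d : ℕ} (j : ℕ) : Measurable (cell (d := d) j) := by
  unfold cell
  fun_prop

theorem cell_eq_cell_div {d : ℕ} {i j : ℕ} (hij : i ≤ j) (x : Cube d) :
    cell i x = fun l => cell j x l / 2 ^ (j - i) := by
  funext l
  simp only [cell]
  rw [← Nat.floor_div_natCast]
  congr 1
  push_cast
  rw [eq_div_iff (by positivity)]
  have : (2 : ℝ) ^ j = 2 ^ i * 2 ^ (j - i) := by rw [← pow_add]; congr 1; omega
  rw [this]
  ring

theorem cell_eq_of_le {d : ℕ} (i j : ℕ) (hij : i ≤ j) (x y : Cube d)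
    (h : cell j x = cell j y) : cell i x = cell i y := by
  rw [cell_eq_cell_div hij, cell_eq_cell_div hij, h]

theorem dist_le_of_cell_eq {d : ℕ} {j : ℕ} {x y : Cube d} (h : cell j x = cell j y) :
    dist x y ≤ 1 / 2 ^ j := by
  rw [dist_pi_le_iff (by positivity)]
  intro l
  have hl : ⌊2 ^ j * (x l : ℝ)⌋₊ = ⌊2 ^ j * (y l : ℝ)⌋₊ := congrFun h l
  have hx0 : 0 ≤ 2 ^ j * (x l : ℝ) := mul_nonneg (by positivity) (x l).2.1
  have hy0 : 0 ≤ 2 ^ j * (y l : ℝ) := mul_nonneg (by positivity) (y l).2.1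
  have h1 := Nat.floor_le hx0
  have h2 := Nat.lt_floor_add_one (2 ^ j * (x l : ℝ))
  have h3 := Nat.floor_le hy0
  have h4 := Nat.lt_floor_add_one (2 ^ j * (y l : ℝ))
  rw [hl] at h1 h2
  have e : dist (x l) (y l) * 2 ^ j = |2 ^ j * (x l : ℝ) - 2 ^ j * (y l : ℝ)| := by
    rw [Subtype.dist_eq, Real.dist_eq, ← mul_sub, abs_mul,
      abs_of_pos (show (0 : ℝ) < 2 ^ j by positivity), mul_comm]
  rw [le_div_iff₀ (by positivity), e, abs_le]
  constructor <;> linarith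

theorem dist_cube_le_one {d : ℕ} (x y : Cube d) : dist x y ≤ 1 := by
  rw [dist_pi_le_iff zero_le_one]
  intro l
  rw [Subtype.dist_eq, Real.dist_eq, abs_le]
  have h1 := (x l).2
  have h2 := (y l).2
  constructor <;> linarith [h1.1, h1.2, h2.1, h2.2]

/-- If the labels first differ at level `j`, the points share a cell of side `2^(1-j)`, which is the
weight of that level. -/
theorem dist_le_sum_cell_ne {d : ℕ} (J : ℕ) (x y : Cube d) :
    dist x y ≤ 1 / 2 ^ J +
      ∑ j ∈ Finset.Icc 1 J, 2 / 2 ^ j * (if cell j x ≠ cell j y then 1 else 0) := by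
  induction J with
  | zero => simpa using dist_cube_le_one x y
  | succ J ih =>
    rw [Finset.sum_Icc_succ_top (by omega)]
    have hnn : 0 ≤ ∑ j ∈ Finset.Icc 1 J,
        (2 : ℝ) / 2 ^ j * (if cell j x ≠ cell j y then 1 else 0) :=
      Finset.sum_nonneg fun j _ => mul_nonneg (by positivity) (by split_ifs <;> norm_num)
    by_cases h : cell (J + 1) x = cell (J + 1) y
    · have := dist_le_of_cell_eq h
      simp only [h, ne_eq, not_true_eq_false, if_false]
      linarith
    · simp only [ne_eq, h, not_false_eq_true, if_true]
      have e : (2 : ℝ) / 2 ^ (J + 1) = 1 / 2 ^ J := by rw [pow_succ]; field_simp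
      have : (0 : ℝ) < 1 / 2 ^ (J + 1) := by positivity
      simp only [ne_eq] at ih
      rw [e]
      linarith

/-- The labels that occur at level `j`. -/
def cellLabels (d j : ℕ) : Finset (Fin d → ℕ) := Fintype.piFinset fun _ => Finset.range (2 ^ j + 1)

theorem card_cellLabels (d j : ℕ) : (cellLabels d j).card = (2 ^ j + 1) ^ d := by
  simp [cellLabels]

theorem cell_mem_cellLabels {d : ℕ} (j : ℕ) (x : Cube d) : cell j x ∈ cellLabels d j := by
  simp only [cellLabels, Fintype.mem_piFinset, Finset.mem_range, cell]
  intro l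
  rw [Nat.lt_succ_iff]
  refine Nat.floor_le_of_le ?_
  push_cast
  exact mul_le_of_le_one_right (by positivity) (x l).2.2

/-- The number of points of `x` in the cell labelled `c` at level `j`. -/
noncomputable def cellCount {α : Type*} [Fintype α] {d : ℕ} (x : α → Cube d) (j : ℕ)
    (c : Fin d → ℕ) : ℕ :=
  (Finset.univ.filter fun a => cell j (x a) = c).card

theorem exists_perm_sum_dist_le {α : Type*} [Fintype α] {d : ℕ} (J : ℕ) (x y : α → Cube d) :
    ∃ σ : Equiv.Perm α, ∑ a, dist (x a) (y (σ a)) ≤ Fintype.card α / 2 ^ J +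
      ∑ j ∈ Finset.Icc 1 J, 2 / 2 ^ j *
        ∑ c ∈ cellLabels d j, (Int.natAbs ((cellCount x j c : ℤ) - cellCount y j c) : ℝ) := by
  classical
  obtain ⟨σ, hσ⟩ := exists_perm_card_ne_le (cell (d := d)) cell_eq_of_le J x y
  refine ⟨σ, ?_⟩
  calc ∑ a, dist (x a) (y (σ a))
      ≤ ∑ a, (1 / 2 ^ J + ∑ j ∈ Finset.Icc 1 J,
          2 / 2 ^ j * (if cell j (x a) ≠ cell j (y (σ a)) then 1 else 0)) :=
        Finset.sum_le_sum fun a _ => dist_le_sum_cell_ne J _ _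
    _ = Fintype.card α / 2 ^ J + ∑ j ∈ Finset.Icc 1 J, 2 / 2 ^ j *
          ((Finset.univ.filter fun a => cell j (x a) ≠ cell j (y (σ a))).card : ℝ) := by
        rw [Finset.sum_add_distrib, Finset.sum_comm]
        congr 1
        · simp; ring
        · refine Finset.sum_congr rfl fun j _ => ?_
          rw [← Finset.mul_sum, Finset.sum_boole]
    _ ≤ _ := by
        gcongr with j hj
        have := hσ j hj (cellLabels d j) fun a => cell_mem_cellLabels j _
        unfold cellCount
        exact_mod_cast this

/-- The lower corner of the cell labelled `g` at level `J`. -/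
noncomputable def gridPoint {d J : ℕ} (g : Fin d → Fin (2 ^ J + 1)) : Cube d := fun l =>
  ⟨(g l : ℝ) / 2 ^ J, by positivity, by
    rw [div_le_one (by positivity)]
    exact_mod_cast Nat.lt_succ_iff.1 (g l).2⟩

theorem cell_gridPoint {d J : ℕ} (g : Fin d → Fin (2 ^ J + 1)) :
    cell J (gridPoint g) = fun l => (g l : ℕ) := by
  funext l
  simp only [cell, gridPoint]
  rw [mul_div_cancel₀ _ (by positivity), Nat.floor_natCast]

theorem exists_gridPoint_cell_eq {d : ℕ} (J : ℕ) (x : Cube d) :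
    ∃ g : Fin d → Fin (2 ^ J + 1), ∀ j ≤ J, cell j (gridPoint g) = cell j x := by
  have h := cell_mem_cellLabels J x
  simp only [cellLabels, Fintype.mem_piFinset, Finset.mem_range] at h
  exact ⟨fun l => ⟨cell J x l, h l⟩, fun j hj => cell_eq_of_le j J hj _ _ (cell_gridPoint _)⟩

/-! ### Fitting grid points to noisy counts -/

/-- A measurable choice of a minimizer of an integer-valued function on a finite type. -/
theorem exists_measurable_argmin (α : Type*) [Finite α] [Nonempty α] [MeasurableSpace α] :
    ∃ f : (α → ℕ) → α, Measurable f ∧ ∀ (s : α → ℕ) (a : α), s (f s) ≤ s a := by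
  choose f hf using fun s : α → ℕ => Finite.exists_min s
  -- Integer scores on a finite type form a countable space, so any selection is measurable.
  exact ⟨f, measurable_of_countable f, hf⟩

/-- `2 ^ J` times the weighted `ℓ¹` distance between noisy cell counts and the cell counts of a
dataset of grid points. -/
noncomputable def gridScore {α : Type*} [Fintype α] {d : ℕ} (J : ℕ) (z : ℕ → (Fin d → ℕ) → ℤ)
    (g : α → Fin d → Fin (2 ^ J + 1)) : ℕ :=
  ∑ j ∈ Finset.Icc 1 J, 2 ^ (J - j) *
    ∑ c ∈ cellLabels d j, (z j c - cellCount (fun a : α => gridPoint (g a)) j c).natAbs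

/-- Fitting a dataset of grid points to noisy cell counts costs at most the size of the noise. -/
theorem exists_perm_sum_dist_argmin_le {α : Type*} [Fintype α] {d : ℕ} (J : ℕ) (x : α → Cube d)
    (z : ℕ → (Fin d → ℕ) → ℤ) (g : α → Fin d → Fin (2 ^ J + 1))
    (hg : ∀ g' : α → Fin d → Fin (2 ^ J + 1), gridScore J z g ≤ gridScore J z g') :
    ∃ σ : Equiv.Perm α, ∑ a, dist (x a) (gridPoint (g (σ a))) ≤ Fintype.card α / 2 ^ J +
      2 * ∑ j ∈ Finset.Icc 1 J, 2 / 2 ^ j *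
        ∑ c ∈ cellLabels d j, (Int.natAbs (z j c - cellCount x j c) : ℝ) := by
  -- The rounded data `h` have the cell counts of `x` up to level `J`, so the score of `h` is the
  -- noise alone. The minimizer does no better than the triangle inequality needs: its distance to
  -- the counts of `x` is at most twice the noise.
  choose h hh using fun a => exists_gridPoint_cell_eq J (x a)
  have hcount : ∀ j ∈ Finset.Icc 1 J, ∀ c,
      cellCount (fun a => gridPoint (h a)) j c = cellCount x j c := by
    intro j hj c
    simp only [cellCount, hh _ j (Finset.mem_Icc.1 hj).2]
  have hscore : ∀ g' : α → Fin d → Fin (2 ^ J + 1), ∑ j ∈ Finset.Icc 1 J, (2 : ℝ) / 2 ^ j *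
        ∑ c ∈ cellLabels d j,
          (Int.natAbs (z j c - cellCount (fun a => gridPoint (g' a)) j c) : ℝ) =
      2 / 2 ^ J * (gridScore J z g' : ℝ) := by
    intro g'
    simp only [gridScore, Nat.cast_sum, Nat.cast_mul, Nat.cast_pow, Nat.cast_ofNat, Finset.mul_sum,
      ← mul_assoc]
    refine Finset.sum_congr rfl fun j hj => Finset.sum_congr rfl fun c _ => ?_
    have hj' := (Finset.mem_Icc.1 hj).2
    congr 1
    have : (2 : ℝ) ^ J = 2 ^ j * 2 ^ (J - j) := by rw [← pow_add]; congr 1; omega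
    rw [this]
    field_simp
  have hgh : ∑ j ∈ Finset.Icc 1 J, (2 : ℝ) / 2 ^ j * ∑ c ∈ cellLabels d j,
        (Int.natAbs (z j c - cellCount (fun a : α => gridPoint (g a)) j c) : ℝ) ≤
      ∑ j ∈ Finset.Icc 1 J, (2 : ℝ) / 2 ^ j * ∑ c ∈ cellLabels d j,
        (Int.natAbs (z j c - cellCount x j c) : ℝ) := by
    have e : ∑ j ∈ Finset.Icc 1 J, (2 : ℝ) / 2 ^ j * ∑ c ∈ cellLabels d j,
        (Int.natAbs (z j c - cellCount x j c) : ℝ) = ∑ j ∈ Finset.Icc 1 J, (2 : ℝ) / 2 ^ j *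
        ∑ c ∈ cellLabels d j,
          (Int.natAbs (z j c - cellCount (fun a => gridPoint (h a)) j c) : ℝ) :=
      Finset.sum_congr rfl fun j hj => by simp only [hcount j hj]
    rw [e, hscore, hscore]
    gcongr
    exact hg h
  obtain ⟨σ, hσ⟩ := exists_perm_sum_dist_le J x fun a : α => gridPoint (g a)
  refine ⟨σ, hσ.trans ?_⟩
  rw [two_mul]
  refine add_le_add_right (le_trans ?_ (add_le_add_right hgh _)) _
  rw [← Finset.sum_add_distrib]
  refine Finset.sum_le_sum fun j _ => ?_
  rw [← mul_add, ← Finset.sum_add_distrib]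
  gcongr with c
  have : ((cellCount x j c : ℤ) - cellCount (fun a : α => gridPoint (g a)) j c).natAbs ≤
      (z j c - cellCount x j c).natAbs +
        (z j c - cellCount (fun a : α => gridPoint (g a)) j c).natAbs := by omega
  exact_mod_cast this

/-! ### Dyadic decomposition of time -/

/-- The exponent of the dyadic block of `Finset.Ico 1 T` (see `dyadicBlocks`) that contains `s`. -/
def blockLevel : ℕ → ℕ → ℕ
  | T, s => if _h : T < 2 ∨ s ≤ 1 ∨ (T = s + 1 ∧ T % 2 = 1) then 0
    else blockLevel (T / 2) (s / 2) + 1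
termination_by T => T
decreasing_by omega

/-- A decomposition of `Finset.Ico 1 T` into dyadic blocks; the pair `(k, q)` stands for the block
`Finset.Ico (q * 2 ^ k) ((q + 1) * 2 ^ k)`. -/
def dyadicBlocks : ℕ → List (ℕ × ℕ)
  | T => if _h : T < 2 then [] else (0, 1) ::
    ((dyadicBlocks (T / 2)).map (fun b => (b.1 + 1, b.2)) ++ if T % 2 = 1 then [(0, T - 1)] else [])
termination_by T => T
decreasing_by omega

theorem dyadicBlocks_of_lt {T : ℕ} (h : T < 2) : dyadicBlocks T = [] := by
  rw [dyadicBlocks, dif_pos h]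

theorem dyadicBlocks_of_le {T : ℕ} (h : 2 ≤ T) : dyadicBlocks T = (0, 1) ::
    ((dyadicBlocks (T / 2)).map (fun b => (b.1 + 1, b.2)) ++
      if T % 2 = 1 then [(0, T - 1)] else []) := by
  rw [dyadicBlocks, dif_neg (not_lt.2 h)]

theorem blockLevel_eq_zero {T s : ℕ} (h : T < 2 ∨ s ≤ 1 ∨ (T = s + 1 ∧ T % 2 = 1)) :
    blockLevel T s = 0 := by
  rw [blockLevel, dif_pos h]

theorem blockLevel_eq_succ {T s : ℕ} (h : ¬ (T < 2 ∨ s ≤ 1 ∨ (T = s + 1 ∧ T % 2 = 1))) :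
    blockLevel T s = blockLevel (T / 2) (s / 2) + 1 := by
  rw [blockLevel, dif_neg h]

theorem sum_range_two_mul {M : Type*} [AddCommMonoid M] (n : ℕ) (f : ℕ → M) :
    ∑ i ∈ Finset.range (2 * n), f i = ∑ i ∈ Finset.range n, (f (2 * i) + f (2 * i + 1)) := by
  induction n with
  | zero => simp
  | succ n ih =>
    rw [show 2 * (n + 1) = 2 * n + 1 + 1 by ring, Finset.sum_range_succ, Finset.sum_range_succ,
      Finset.sum_range_succ, ih, add_assoc]

theorem sum_Ico_two_mul {M : Type*} [AddCommMonoid M] {n : ℕ} (hn : 1 ≤ n) (f : ℕ → M) :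
    ∑ s ∈ Finset.Ico 1 (2 * n), f s =
      f 1 + ∑ s ∈ Finset.Ico 1 n, (f (2 * s) + f (2 * s + 1)) := by
  induction n, hn using Nat.le_induction with
  | base => simp
  | succ n hn ih =>
    rw [show 2 * (n + 1) = 2 * n + 1 + 1 by ring, Finset.sum_Ico_succ_top (by omega),
      Finset.sum_Ico_succ_top (by omega), Finset.sum_Ico_succ_top hn, ih]
    simp only [add_assoc]

/-- Summing an arbitrary `f` expresses that the blocks partition the times. Halving works because
`[1, T)` is `1`, the doubled blocks of `[1, T/2)`, and `T - 1` if `T` is odd. -/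
theorem sum_dyadicBlocks {M : Type*} [AddCommMonoid M] (T : ℕ) : ∀ f : ℕ → M,
    ((dyadicBlocks T).map fun b => ∑ i ∈ Finset.range (2 ^ b.1), f (b.2 * 2 ^ b.1 + i)).sum =
      ∑ s ∈ Finset.Ico 1 T, f s := by
  induction T using Nat.strong_induction_on with
  | _ T ih =>
    intro f
    rcases lt_or_ge T 2 with h | h
    · rw [dyadicBlocks_of_lt h, Finset.Ico_eq_empty (by omega)]
      simp
    · have hdouble : ∀ b : ℕ × ℕ, ∑ i ∈ Finset.range (2 ^ (b.1 + 1)), f (b.2 * 2 ^ (b.1 + 1) + i) =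
          ∑ i ∈ Finset.range (2 ^ b.1),
            (f (2 * (b.2 * 2 ^ b.1 + i)) + f (2 * (b.2 * 2 ^ b.1 + i) + 1)) := by
        intro b
        rw [pow_succ', sum_range_two_mul]
        refine Finset.sum_congr rfl fun i _ => ?_
        congr 2 <;> ring
      have hrec := ih (T / 2) (by omega) fun s => f (2 * s) + f (2 * s + 1)
      have hT2 := sum_Ico_two_mul (n := T / 2) (by omega) f
      rw [dyadicBlocks_of_le h]
      simp only [List.map_cons, List.sum_cons, List.map_append, List.sum_append, List.map_map,
        Function.comp_def, hdouble, hrec]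
      rw [← add_assoc]
      have e1 : ∑ i ∈ Finset.range (2 ^ 0), f (1 * 2 ^ 0 + i) = f 1 := by simp
      rw [e1, ← hT2]
      rcases Nat.mod_two_eq_zero_or_one T with h0 | h0
      · rw [if_neg (by omega), show 2 * (T / 2) = T by omega]
        simp
      · obtain ⟨n, rfl⟩ : ∃ n, T = n + 1 := ⟨T - 1, by omega⟩
        rw [if_pos h0, show 2 * ((n + 1) / 2) = n by omega, Finset.sum_Ico_succ_top (by omega)]
        simp

/-- Reconciles the two descriptions of the decomposition: the list, which the error analysis sums
over, and `blockLevel`, by which the algorithm locates the block of a given time. -/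
theorem of_mem_dyadicBlocks (T : ℕ) : ∀ b ∈ dyadicBlocks T, 1 ≤ b.2 ∧ (b.2 + 1) * 2 ^ b.1 ≤ T ∧
    ∀ i < 2 ^ b.1, blockLevel T (b.2 * 2 ^ b.1 + i) = b.1 := by
  induction T using Nat.strong_induction_on with
  | _ T ih =>
    intro b hb
    rcases lt_or_ge T 2 with h | h
    · simp [dyadicBlocks_of_lt h] at hb
    · rw [dyadicBlocks_of_le h, List.mem_cons, List.mem_append, List.mem_map] at hb
      rcases hb with rfl | ⟨b, hb, rfl⟩ | hb
      · refine ⟨le_rfl, by simpa using h, fun i hi => blockLevel_eq_zero (Or.inr (Or.inl ?_))⟩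
        simp at hi
        simp [hi]
      · obtain ⟨h1, h2, h3⟩ := ih (T / 2) (by omega) b hb
        have h4 : (b.2 + 1) * 2 ^ (b.1 + 1) ≤ 2 * (T / 2) := by
          rw [pow_succ]; nlinarith
        refine ⟨h1, by simp only; omega, fun i hi => ?_⟩
        simp only at hi ⊢
        have h5 : b.2 * 2 ^ (b.1 + 1) + i < (b.2 + 1) * 2 ^ (b.1 + 1) := by linarith
        have h6 : 2 ≤ b.2 * 2 ^ (b.1 + 1) := by
          have := Nat.one_le_two_pow (n := b.1)
          rw [pow_succ]; nlinarith
        rw [blockLevel_eq_succ (by omega)]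
        have h7 : (b.2 * 2 ^ (b.1 + 1) + i) / 2 = b.2 * 2 ^ b.1 + i / 2 := by
          rw [pow_succ, ← mul_assoc]; omega
        rw [h7, h3 (i / 2) (by rw [pow_succ] at hi; omega)]
      · split_ifs at hb with h0
        · simp only [List.mem_singleton] at hb
          subst hb
          refine ⟨by simp only; omega, by simp only [pow_zero]; omega,
            fun i hi => blockLevel_eq_zero (Or.inr (Or.inr ?_))⟩
          simp at hi
          simp only [hi, pow_zero]
          omega
        · simp at hb

theorem blockLevel_spec (T : ℕ) : ∀ s, 1 ≤ s → s < T →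
    1 ≤ s / 2 ^ blockLevel T s ∧ (s / 2 ^ blockLevel T s + 1) * 2 ^ blockLevel T s ≤ T := by
  induction T using Nat.strong_induction_on with
  | _ T ih =>
    intro s h1 h2
    by_cases h : T < 2 ∨ s ≤ 1 ∨ (T = s + 1 ∧ T % 2 = 1)
    · rw [blockLevel_eq_zero h]
      simp
      omega
    · rw [blockLevel_eq_succ h]
      obtain ⟨h3, h4⟩ := ih (T / 2) (by omega) (s / 2) (by omega) (by omega)
      have e : s / 2 ^ (blockLevel (T / 2) (s / 2) + 1) =
          s / 2 / 2 ^ blockLevel (T / 2) (s / 2) := by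
        rw [pow_succ', Nat.div_div_eq_div_mul]
      rw [e]
      refine ⟨h3, ?_⟩
      rw [pow_succ]
      have : 2 * (T / 2) ≤ T := by omega
      nlinarith

/-- Each step of the recursion adds at most two blocks of size one and doubles the others, so no
size occurs more than twice. -/
theorem sum_dyadicBlocks_fst_le (T : ℕ) : ∀ φ : ℕ → ℝ, (∀ k, 0 ≤ φ k) →
    ((dyadicBlocks T).map fun b => φ b.1).sum ≤ 2 * ∑ k ∈ Finset.range (Nat.log 2 T), φ k := by
  induction T using Nat.strong_induction_on with
  | _ T ih =>
    intro φ hφ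
    rcases lt_or_ge T 2 with h | h
    · rw [dyadicBlocks_of_lt h]
      simp only [List.map_nil, List.sum_nil]
      have := Finset.sum_nonneg fun k (_ : k ∈ Finset.range (Nat.log 2 T)) => hφ k
      linarith
    · have hrec := ih (T / 2) (by omega) (fun k => φ (k + 1)) fun k => hφ _
      rw [dyadicBlocks_of_le h, Nat.log_of_one_lt_of_le one_lt_two h, Finset.sum_range_succ']
      simp only [List.map_cons, List.sum_cons, List.map_append, List.sum_append, List.map_map,
        Function.comp_def]
      have : ((if T % 2 = 1 then [(0, T - 1)] else []).map fun b : ℕ × ℕ => φ b.1).sum ≤ φ 0 := by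
        split_ifs
        · simp
        · simpa using hφ 0
      linarith

/-- The matchings of the separate blocks are glued into one coupling. -/
theorem wassersteinOne_empiricalMeasure_le {d t : ℕ} (x y : ℕ → Cube d)
    (σ : ∀ b : ℕ × ℕ, Equiv.Perm (Fin (2 ^ b.1))) :
    wassersteinOne (empiricalMeasure fun i : Fin t => x (i + 1))
        (empiricalMeasure fun i : Fin t => y (i + 1)) ≤
      (t : ℝ≥0∞)⁻¹ * ((dyadicBlocks (t + 1)).map fun b => ∑ i : Fin (2 ^ b.1),
        edist (x (b.2 * 2 ^ b.1 + i)) (y (b.2 * 2 ^ b.1 + σ b i))).sum := by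
  set γ : Measure (Cube d × Cube d) := (t : ℝ≥0∞)⁻¹ • ((dyadicBlocks (t + 1)).map fun b =>
    ∑ i : Fin (2 ^ b.1), Measure.dirac
      (x (b.2 * 2 ^ b.1 + i), y (b.2 * 2 ^ b.1 + σ b i))).sum with hγ
  have hsum : ∀ z : ℕ → Cube d, ((dyadicBlocks (t + 1)).map fun b =>
      ∑ i : Fin (2 ^ b.1), Measure.dirac (z (b.2 * 2 ^ b.1 + i))).sum =
      ∑ i : Fin t, Measure.dirac (z (i + 1)) := by
    intro z
    have := sum_dyadicBlocks (t + 1) fun s => Measure.dirac (z s)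
    rw [Finset.sum_Ico_eq_sum_range] at this
    simp only [Finset.sum_range, Nat.add_sub_cancel] at this
    rw [this]
    simp only [add_comm 1]
  have hfst : γ.fst = empiricalMeasure fun i : Fin t => x (i + 1) := by
    rw [Measure.fst, ← Measure.mapₗ_apply_of_measurable measurable_fst, hγ, map_smul, map_list_sum,
      List.map_map, empiricalMeasure, ← hsum]
    congr 3
    funext b
    simp only [Function.comp_apply, map_sum]
    refine Finset.sum_congr rfl fun i _ => ?_
    rw [Measure.mapₗ_apply_of_measurable measurable_fst, Measure.map_dirac' measurable_fst]
  have hsnd : γ.snd = empiricalMeasure fun i : Fin t => y (i + 1) := by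
    rw [Measure.snd, ← Measure.mapₗ_apply_of_measurable measurable_snd, hγ, map_smul, map_list_sum,
      List.map_map, empiricalMeasure, ← hsum]
    congr 3
    funext b
    simp only [Function.comp_apply, map_sum]
    rw [← Equiv.sum_comp (σ b) fun i => Measure.dirac (y (b.2 * 2 ^ b.1 + i))]
    refine Finset.sum_congr rfl fun i _ => ?_
    rw [Measure.mapₗ_apply_of_measurable measurable_snd, Measure.map_dirac' measurable_snd]
  refine (iInf₂_le_of_le γ hfst (iInf_le _ hsnd)).trans (le_of_eq ?_)
  rw [hγ, lintegral_smul_measure, smul_eq_mul]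
  congr 1
  induction dyadicBlocks (t + 1) with
  | nil => simp
  | cons b l ih =>
    simp only [List.map_cons, List.sum_cons]
    rw [lintegral_add_measure, ih, lintegral_finsetSum_measure]
    simp only [lintegral_dirac]

/-! ### The algorithm -/

/-- A cell count is indexed by a dyadic block of time, a level and a cell label. -/
abbrev CountIndex (d : ℕ) : Type := (ℕ × ℕ) × ℕ × (Fin d → ℕ)

/-- The data points of the block `b`; the point `x i` arrives at time `i + 1`. -/
def blockData {d : ℕ} (x : DataStream d) (b : ℕ × ℕ) : Fin (2 ^ b.1) → Cube d :=
  fun i => x (b.2 * 2 ^ b.1 + i - 1)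

/-- The cell counts of all blocks, up to the level `J b` in the block `b`. -/
noncomputable def blockCount {d : ℕ} (J : ℕ × ℕ → ℕ) (x : DataStream d) (a : CountIndex d) : ℤ :=
  -- The zero value keeps the blocks with `q = 0`, present at every scale, from using up privacy.
  -- The condition `1 ≤ q` also makes the truncated subtraction in `blockData` exact.
  if 1 ≤ a.1.2 ∧ a.2.1 ∈ Finset.Icc 1 (J a.1) then cellCount (blockData x a.1) a.2.1 a.2.2 else 0

/-- A measurable minimizer. -/
noncomputable def argmin (α : Type*) [Finite α] [Nonempty α] [MeasurableSpace α] : (α → ℕ) → α :=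
  (exists_measurable_argmin α).choose

theorem measurable_argmin (α : Type*) [Finite α] [Nonempty α] [MeasurableSpace α] :
    Measurable (argmin α) := (exists_measurable_argmin α).choose_spec.1

theorem argmin_le {α : Type*} [Finite α] [Nonempty α] [MeasurableSpace α] (s : α → ℕ) (a : α) :
    s (argmin α s) ≤ s a := (exists_measurable_argmin α).choose_spec.2 s a

/-- The synthetic data of the block `b`, fitted to the noisy counts `w`. -/
noncomputable def blockSynthetic {d : ℕ} (J : ℕ × ℕ → ℕ) (w : CountIndex d → ℤ) (b : ℕ × ℕ) :
    Fin (2 ^ b.1) → Cube d := fun i =>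
  gridPoint (argmin (Fin (2 ^ b.1) → Fin d → Fin (2 ^ J b + 1))
    (fun g => gridScore (J b) (fun j c => w (b, j, c)) g) i)

/-- The block that contains the time `i + 1` in the decomposition of `1, …, t`. -/
def blockOf (t i : ℕ) : ℕ × ℕ :=
  (blockLevel (t + 1) (i + 1), (i + 1) / 2 ^ blockLevel (t + 1) (i + 1))

/-- The synthetic data at time `t`: the concatenation of the synthetic data of the blocks. -/
noncomputable def syntheticData {d : ℕ} (J : ℕ × ℕ → ℕ) (w : CountIndex d → ℤ) (t : ℕ) :
    Dataset d t := fun i =>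
  blockSynthetic J w (blockOf t i)
    ⟨(i + 1) % 2 ^ (blockOf t i).1, Nat.mod_lt _ (by positivity)⟩

/-- A stream that begins with the dataset `X`. -/
noncomputable def Dataset.extend {d t : ℕ} (X : Dataset d t) : DataStream d :=
  fun i => if h : i < t then X ⟨i, h⟩ else fun _ => 0

theorem measurable_blockSynthetic {d : ℕ} (J : ℕ × ℕ → ℕ) (b : ℕ × ℕ) :
    Measurable fun w : CountIndex d → ℤ => blockSynthetic J w b := by
  have hscore : Measurable fun w : CountIndex d → ℤ =>
      fun g : Fin (2 ^ b.1) → Fin d → Fin (2 ^ J b + 1) =>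
        gridScore (J b) (fun j c => w (b, j, c)) g := by
    refine measurable_pi_lambda _ fun g => ?_
    unfold gridScore
    refine Finset.measurable_sum _ fun j _ => Measurable.const_mul ?_ _
    refine Finset.measurable_sum _ fun c _ => ?_
    exact (measurable_of_countable fun n : ℤ =>
      (n - cellCount (fun a => gridPoint (g a)) j c).natAbs).comp (measurable_pi_apply (b, j, c))
  have hgrid : Measurable fun g : Fin (2 ^ b.1) → Fin d → Fin (2 ^ J b + 1) =>
      fun i => gridPoint (g i) := measurable_of_countable _
  exact hgrid.comp ((measurable_argmin _).comp hscore)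

theorem measurable_syntheticData {d : ℕ} (J : ℕ × ℕ → ℕ) (t : ℕ) :
    Measurable fun w : CountIndex d → ℤ => syntheticData J w t :=
  measurable_pi_lambda _ fun _ => (measurable_pi_apply _).comp (measurable_blockSynthetic J _)

theorem measurable_extend {d t : ℕ} : Measurable (Dataset.extend : Dataset d t → DataStream d) := by
  refine measurable_pi_lambda _ fun i => ?_
  unfold Dataset.extend
  split_ifs with h
  · exact measurable_pi_apply _
  · exact measurable_const

theorem measurable_blockCount {d : ℕ} (J : ℕ × ℕ → ℕ) (a : CountIndex d) :
    Measurable fun x : DataStream d => blockCount J x a := by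
  unfold blockCount
  split_ifs
  · simp only [cellCount, Finset.card_filter]
    push_cast
    refine Finset.measurable_sum _ fun i _ => ?_
    refine Measurable.ite ?_ measurable_const measurable_const
    have : Measurable fun x : DataStream d => cell a.2.1 (blockData x a.1 i) :=
      (measurable_cell _).comp (measurable_pi_apply _)
    exact this (MeasurableSet.singleton _)
  · exact measurable_const

/-- The algorithm that adds discrete Laplace noise to the cell counts of all dyadic blocks and fits
synthetic data to the noisy counts. -/
noncomputable def noisyCountAlgorithm {d : ℕ} (J : ℕ × ℕ → ℕ)
    (r : CountIndex d → {r : ℝ // 0 < r}) : OnlineAlgorithm d where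
  Ω := CountIndex d → ℤ
  P := Measure.infinitePi fun a => discreteLaplace (r a)
  A t X ω := syntheticData J (fun a => blockCount J X.extend a + ω a) t
  measurable_A t := by
    refine (measurable_syntheticData J t).comp (measurable_pi_lambda _ fun a => ?_)
    have h1 : Measurable fun p : Dataset d t × (CountIndex d → ℤ) => blockCount J p.1.extend a :=
      (measurable_blockCount J a).comp (measurable_extend.comp measurable_fst)
    have h2 : Measurable fun p : Dataset d t × (CountIndex d → ℤ) => p.2 a :=
      (measurable_pi_apply a).comp measurable_snd
    exact h1.add h2

theorem blockCount_extend_upTo {d t : ℕ} (J : ℕ × ℕ → ℕ) (x : DataStream d) {b : ℕ × ℕ}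
    (h1 : 1 ≤ b.2) (h2 : (b.2 + 1) * 2 ^ b.1 ≤ t + 1) (j : ℕ) (c : Fin d → ℕ) :
    blockCount J (x.upTo t).extend (b, j, c) = blockCount J x (b, j, c) := by
  have : blockData (x.upTo t).extend b = blockData x b := by
    funext i
    have h3 : b.2 * 2 ^ b.1 + i - 1 < t := by
      have := i.2
      have := Nat.one_le_two_pow (n := b.1)
      have : 1 ≤ b.2 * 2 ^ b.1 := Nat.mul_le_mul h1 this
      rw [add_mul] at h2
      omega
    simp [blockData, Dataset.extend, DataStream.upTo, h3]
  simp only [blockCount, this]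

/-- The blocks used at time `t` end by then, so the padding by `0` in `Dataset.extend` is never
read. Hence the same noisy counts, those of the whole stream, drive the outputs at all times. -/
theorem output_noisyCountAlgorithm {d : ℕ} (J : ℕ × ℕ → ℕ) (r : CountIndex d → {r : ℝ // 0 < r})
    (x : DataStream d) (ω : CountIndex d → ℤ) :
    (noisyCountAlgorithm J r).output x ω =
      syntheticData J (fun a => blockCount J x a + ω a) := by
  funext t i
  have h := blockLevel_spec (t + 1) (i + 1) (by omega) (by omega)
  simp only [OnlineAlgorithm.output, noisyCountAlgorithm, syntheticData, blockSynthetic]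
  simp only [blockCount_extend_upTo (b := blockOf t i) J x h.1 h.2]

/-! ### Privacy -/

theorem cellCount_sub_of_eq_off {α : Type*} [Fintype α] {d : ℕ} {x y : α → Cube d} {i : α}
    (h : ∀ a, a ≠ i → x a = y a) (j : ℕ) (c : Fin d → ℕ) :
    (cellCount x j c : ℤ) - cellCount y j c =
      (if cell j (x i) = c then 1 else 0) - (if cell j (y i) = c then 1 else 0) := by
  classical
  simp only [cellCount, Finset.card_filter]
  push_cast
  rw [← Finset.add_sum_erase _ _ (Finset.mem_univ i), ← Finset.add_sum_erase (Finset.univ)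
    (fun a => if cell j (y a) = c then (1 : ℤ) else 0) (Finset.mem_univ i)]
  have : ∑ a ∈ Finset.univ.erase i, (if cell j (x a) = c then (1 : ℤ) else 0) =
      ∑ a ∈ Finset.univ.erase i, (if cell j (y a) = c then (1 : ℤ) else 0) :=
    Finset.sum_congr rfl fun a ha => by rw [h a (Finset.ne_of_mem_erase ha)]
  rw [this]
  ring

theorem blockCount_sub_of_eq_off {d : ℕ} (J : ℕ × ℕ → ℕ) {x x' : DataStream d} {i : ℕ}
    (h : ∀ j, j ≠ i → x j = x' j) (a : CountIndex d) :
    (blockCount J x a - blockCount J x' a).natAbs ≤ 1 ∧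
      (blockCount J x a - blockCount J x' a ≠ 0 → a.1.1 ≤ Nat.log 2 (i + 1) ∧
        a.1.2 = (i + 1) / 2 ^ a.1.1 ∧ a.2.1 ∈ Finset.Icc 1 (J a.1) ∧
        (a.2.2 = cell a.2.1 (x i) ∨ a.2.2 = cell a.2.1 (x' i))) := by
  obtain ⟨⟨k, q⟩, j, c⟩ := a
  by_cases hu : 1 ≤ q ∧ j ∈ Finset.Icc 1 (J (k, q))
  · simp only [blockCount, hu, and_self, if_true]
    have hpos : 1 ≤ q * 2 ^ k := Nat.mul_le_mul hu.1 Nat.one_le_two_pow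
    by_cases hi : ∃ n : Fin (2 ^ k), q * 2 ^ k + n - 1 = i
    · obtain ⟨n, hn⟩ := hi
      have hn' : i + 1 = n + 2 ^ k * q := by rw [mul_comm (2 ^ k)]; omega
      have hoff : ∀ m, m ≠ n → blockData x (k, q) m = blockData x' (k, q) m := by
        intro m hm
        refine h _ fun hmi => hm (Fin.ext ?_)
        simp only at hmi
        omega
      have hxi : blockData x (k, q) n = x i := by simp only [blockData, hn]
      have hxi' : blockData x' (k, q) n = x' i := by simp only [blockData, hn]
      rw [cellCount_sub_of_eq_off hoff, hxi, hxi']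
      refine ⟨by split_ifs <;> simp, fun hne => ⟨?_, ?_, trivial, ?_⟩⟩
      · refine Nat.le_log_of_pow_le one_lt_two ?_
        nlinarith [hu.1, Nat.one_le_two_pow (n := k)]
      · rw [hn', Nat.add_mul_div_left _ _ (by positivity), Nat.div_eq_of_lt n.2, zero_add]
      · by_contra hcon
        push Not at hcon
        refine hne ?_
        rw [if_neg hcon.1.symm, if_neg hcon.2.symm, sub_zero]
    · have : blockData x (k, q) = blockData x' (k, q) := by
        funext n
        exact h _ fun hn => hi ⟨n, hn⟩
      simp [this]
  · simp only [blockCount, hu, if_false]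
    simp

theorem sum_rate_mul_natAbs_le {d : ℕ} (J : ℕ × ℕ → ℕ) (r : ℕ × ℕ → ℕ → {r : ℝ // 0 < r}) {ε : ℝ}
    (hr : ∀ b : ℕ × ℕ, ∑ j ∈ Finset.Icc 1 (J b), (r b j : ℝ) ≤
      ε / (2 * (Nat.log 2 ((b.2 + 1) * 2 ^ b.1) + 1)))
    (hε : 0 < ε) {x x' : DataStream d} (h : x.Neighbors x') (s : Finset (CountIndex d)) :
    ∑ a ∈ s, (r a.1 a.2.1 : ℝ) * (blockCount J x a - blockCount J x' a).natAbs ≤ ε := by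
  classical
  obtain ⟨i, hi⟩ := h
  set K := Nat.log 2 (i + 1)
  let β : ℕ → ℕ × ℕ := fun k => (k, (i + 1) / 2 ^ k)
  let V : (Σ _ : ℕ, Σ _ : ℕ, Fin d → ℕ) → CountIndex d := fun p => (β p.1, p.2.1, p.2.2)
  -- All counts that the change at time `i + 1` can affect: one block per `k ≤ K`, and per level the
  -- cells of the old and the new point.
  let F : Finset (Σ _ : ℕ, Σ _ : ℕ, Fin d → ℕ) := (Finset.range (K + 1)).sigma fun k =>
    (Finset.Icc 1 (J (β k))).sigma fun j => {cell j (x i), cell j (x' i)}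
  have hinj : Function.Injective V := by
    rintro ⟨k, j, c⟩ ⟨k', j', c'⟩ hV
    simp only [V, β, Prod.mk.injEq] at hV
    obtain ⟨⟨rfl, -⟩, rfl, rfl⟩ := hV
    rfl
  calc ∑ a ∈ s, (r a.1 a.2.1 : ℝ) * (blockCount J x a - blockCount J x' a).natAbs
      ≤ ∑ a ∈ s, if a ∈ F.image V then (r a.1 a.2.1 : ℝ) else 0 := by
        refine Finset.sum_le_sum fun a _ => ?_
        obtain ⟨h1, h2⟩ := blockCount_sub_of_eq_off J hi a
        by_cases hne : blockCount J x a - blockCount J x' a = 0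
        · rw [hne]
          split_ifs
          · simpa using (r a.1 a.2.1).2.le
          · simp
        · obtain ⟨h3, h4, h5, h6⟩ := h2 hne
          have hmem : a ∈ F.image V := by
            refine Finset.mem_image.2 ⟨⟨a.1.1, a.2.1, a.2.2⟩, ?_, ?_⟩
            · have h7 : β a.1.1 = a.1 := by
                simp only [β]
                rw [← h4]
              simp only [F, Finset.mem_sigma, Finset.mem_range, Finset.mem_insert,
                Finset.mem_singleton, h7]
              exact ⟨by omega, h5, h6⟩
            · simp only [V, β]
              rw [← h4]
          rw [if_pos hmem]
          have : ((blockCount J x a - blockCount J x' a).natAbs : ℝ) ≤ 1 := by exact_mod_cast h1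
          exact mul_le_of_le_one_right (r a.1 a.2.1).2.le this
    _ ≤ ∑ a ∈ F.image V, (r a.1 a.2.1 : ℝ) := by
        rw [← Finset.sum_filter]
        refine Finset.sum_le_sum_of_subset_of_nonneg (fun a ha => (Finset.mem_filter.1 ha).2) ?_
        exact fun a _ _ => (r a.1 a.2.1).2.le
    _ = ∑ k ∈ Finset.range (K + 1), ∑ j ∈ Finset.Icc 1 (J (β k)),
          ∑ _c ∈ ({cell j (x i), cell j (x' i)} : Finset (Fin d → ℕ)), (r (β k) j : ℝ) := by
        rw [Finset.sum_image fun p _ p' _ hp => hinj hp]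
        simp only [F, Finset.sum_sigma, V]
    _ ≤ ∑ k ∈ Finset.range (K + 1), ∑ j ∈ Finset.Icc 1 (J (β k)), 2 * (r (β k) j : ℝ) := by
        gcongr with k _ j _
        rw [Finset.sum_const, nsmul_eq_mul]
        refine mul_le_mul_of_nonneg_right ?_ (r (β k) j).2.le
        exact_mod_cast Finset.card_le_two
    _ ≤ ∑ k ∈ Finset.range (K + 1), ε / (K + 1) := by
        refine Finset.sum_le_sum fun k _ => ?_
        rw [← Finset.mul_sum]
        -- The block contains time `i + 1`, so its right end is later and its budget is at most the
        -- one computed with `K`.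
        have hK : K ≤ Nat.log 2 (((β k).2 + 1) * 2 ^ (β k).1) := by
          refine Nat.log_mono_right ?_
          have := Nat.lt_div_mul_add (a := i + 1) (b := 2 ^ k) (by positivity)
          simp only [β]
          nlinarith
        have hK' : (K : ℝ) ≤ Nat.log 2 (((β k).2 + 1) * 2 ^ (β k).1) := by exact_mod_cast hK
        calc 2 * ∑ j ∈ Finset.Icc 1 (J (β k)), (r (β k) j : ℝ)
            ≤ 2 * (ε / (2 * (Nat.log 2 (((β k).2 + 1) * 2 ^ (β k).1) + 1))) := by
              gcongr; exact hr _
          _ ≤ 2 * (ε / (2 * (K + 1))) := by gcongr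
          _ = ε / (K + 1) := by field_simp
    _ = ε := by
        rw [Finset.sum_const, Finset.card_range, nsmul_eq_mul]
        push_cast
        field_simp

theorem isDifferentiallyPrivate_noisyCountAlgorithm {d : ℕ} (J : ℕ × ℕ → ℕ)
    (r : ℕ × ℕ → ℕ → {r : ℝ // 0 < r}) {ε : ℝ} (hε : 0 < ε)
    (hr : ∀ b : ℕ × ℕ, ∑ j ∈ Finset.Icc 1 (J b), (r b j : ℝ) ≤
      ε / (2 * (Nat.log 2 ((b.2 + 1) * 2 ^ b.1) + 1))) :
    (noisyCountAlgorithm (d := d) J fun a => r a.1 a.2.1).IsDifferentiallyPrivate ε := by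
  intro x x' hx S hS
  have hout : ∀ y : DataStream d,
      {ω | (noisyCountAlgorithm J fun a => r a.1 a.2.1).output y ω ∈ S} =
        {ω : CountIndex d → ℤ | syntheticData J (fun a => blockCount J y a + ω a) ∈ S} := fun y =>
    Set.ext fun ω => iff_of_eq (congrArg (· ∈ S) (output_noisyCountAlgorithm J _ y ω))
  rw [hout x, hout x']
  have hT : MeasurableSet {w : CountIndex d → ℤ | syntheticData J w ∈ S} :=
    (measurable_pi_lambda _ fun t => measurable_syntheticData J t) hS
  exact infinitePi_discreteLaplace_shift_le (fun a : CountIndex d => r a.1 a.2.1)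
    (blockCount J x) (blockCount J x') ε (sum_rate_mul_natAbs_le J r hr hε hx) hT

/-! ### Expected error -/

/-- A bound for the transport cost in the block `b`: the discretization error and the noise in the
cell counts, weighted by the sizes of the cells. -/
noncomputable def blockNoise {d : ℕ} (J : ℕ × ℕ → ℕ) (ω : CountIndex d → ℤ) (b : ℕ × ℕ) : ℝ :=
  2 ^ b.1 / 2 ^ J b + 2 * ∑ j ∈ Finset.Icc 1 (J b), 2 / 2 ^ j *
    ∑ c ∈ cellLabels d j, ((ω (b, j, c)).natAbs : ℝ)

theorem exists_perm_blockSynthetic {d : ℕ} (J : ℕ × ℕ → ℕ) (x : DataStream d)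
    (ω : CountIndex d → ℤ) {b : ℕ × ℕ} (hb : 1 ≤ b.2) :
    ∃ σ : Equiv.Perm (Fin (2 ^ b.1)), ∑ i, edist (blockData x b i)
        (blockSynthetic J (fun a => blockCount J x a + ω a) b (σ i)) ≤
      ENNReal.ofReal (blockNoise J ω b) := by
  obtain ⟨σ, hσ⟩ := exists_perm_sum_dist_argmin_le (J b) (blockData x b)
    (fun j c => blockCount J x (b, j, c) + ω (b, j, c)) _ (argmin_le _)
  refine ⟨σ, ?_⟩
  simp only [edist_dist]
  rw [← ENNReal.ofReal_sum_of_nonneg fun _ _ => dist_nonneg]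
  refine ENNReal.ofReal_le_ofReal (hσ.trans (le_of_eq ?_))
  rw [blockNoise, Fintype.card_fin]
  push_cast
  congr 2
  refine Finset.sum_congr rfl fun j hj => ?_
  congr 1
  refine Finset.sum_congr rfl fun c _ => ?_
  have : blockCount J x (b, j, c) = cellCount (blockData x b) j c := by
    simp only [blockCount, hb, hj, and_self, if_true]
  rw [this, add_sub_cancel_left]

theorem syntheticData_apply_of_mem {d : ℕ} (J : ℕ × ℕ → ℕ) (w : CountIndex d → ℤ) {t : ℕ}
    {b : ℕ × ℕ} (hb : b ∈ dyadicBlocks (t + 1)) (n : Fin (2 ^ b.1)) (i : Fin t)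
    (hi : (i : ℕ) + 1 = b.2 * 2 ^ b.1 + n) :
    syntheticData J w t i = blockSynthetic J w b n := by
  obtain ⟨-, -, h3⟩ := of_mem_dyadicBlocks _ b hb
  have hblock : blockOf t i = b := by
    rw [blockOf, hi, h3 n n.2, mul_comm, add_comm, Nat.add_mul_div_left _ _ (by positivity),
      Nat.div_eq_of_lt n.2, zero_add]
  have hgen : ∀ (b' : ℕ × ℕ) (m : Fin (2 ^ b'.1)), b' = b → (m : ℕ) = n →
      blockSynthetic J w b' m = blockSynthetic J w b n := by
    rintro b' m rfl hm
    rw [Fin.ext hm]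
  refine hgen _ _ hblock ?_
  simp only [hblock, hi]
  rw [mul_comm, add_comm, Nat.add_mul_mod_self_left, Nat.mod_eq_of_lt n.2]

theorem wassersteinOne_syntheticData_le {d : ℕ} (J : ℕ × ℕ → ℕ) (x : DataStream d)
    (ω : CountIndex d → ℤ) (t : ℕ) :
    wassersteinOne (empiricalMeasure (x.upTo t))
        (empiricalMeasure (syntheticData J (fun a => blockCount J x a + ω a) t)) ≤
      (t : ℝ≥0∞)⁻¹ * ((dyadicBlocks (t + 1)).map fun b =>
        ENNReal.ofReal (blockNoise J ω b)).sum := by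
  generalize hw : (fun a => blockCount J x a + ω a) = w
  have hσ : ∀ b : ℕ × ℕ, ∃ σ : Equiv.Perm (Fin (2 ^ b.1)), 1 ≤ b.2 →
      ∑ i, edist (blockData x b i) (blockSynthetic J w b (σ i)) ≤
        ENNReal.ofReal (blockNoise J ω b) := by
    intro b
    by_cases hb : 1 ≤ b.2
    · obtain ⟨σ, h⟩ := exists_perm_blockSynthetic J x ω hb
      rw [hw] at h
      exact ⟨σ, fun _ => h⟩
    · exact ⟨1, fun h => absurd h hb⟩
  choose σ hσ using hσ
  -- The synthetic data as a sequence indexed by time; the default value `x 0` lies outside the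
  -- times in use.
  obtain ⟨y, hy⟩ : ∃ y : ℕ → Cube d, ∀ i : Fin t, y ((i : ℕ) + 1) = syntheticData J w t i :=
    ⟨fun s => if h : s - 1 < t then syntheticData J w t ⟨s - 1, h⟩ else x 0, fun i =>
      dif_pos (show (i : ℕ) + 1 - 1 < t from i.2)⟩
  have hy' : syntheticData J w t = fun i : Fin t => y ((i : ℕ) + 1) := funext fun i => (hy i).symm
  have hmain := wassersteinOne_empiricalMeasure_le (t := t) (fun s => x (s - 1)) y σ
  rw [← hy'] at hmain
  refine hmain.trans ?_
  gcongr
  refine List.sum_le_sum fun b hb => ?_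
  obtain ⟨h1, h2, -⟩ := of_mem_dyadicBlocks _ b hb
  refine (le_of_eq ?_).trans (hσ b h1)
  refine Finset.sum_congr rfl fun i _ => ?_
  have hpos : 1 ≤ b.2 * 2 ^ b.1 := Nat.mul_le_mul h1 Nat.one_le_two_pow
  have hn := (σ b i).2
  rw [add_mul] at h2
  have hlt : b.2 * 2 ^ b.1 + (σ b i : ℕ) - 1 < t := by omega
  have hs : b.2 * 2 ^ b.1 + (σ b i : ℕ) - 1 + 1 = b.2 * 2 ^ b.1 + (σ b i : ℕ) := by omega
  have hyi := hy ⟨_, hlt⟩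
  rw [syntheticData_apply_of_mem J w hb (σ b i) ⟨_, hlt⟩ hs] at hyi
  simp only [hs] at hyi
  rw [hyi, blockData]

theorem lintegral_list_sum {α Ω : Type*} [MeasurableSpace Ω] (μ : Measure Ω) (l : List α)
    (f : α → Ω → ℝ≥0∞) (hf : ∀ a, Measurable (f a)) :
    ∫⁻ ω, (l.map fun a => f a ω).sum ∂μ = (l.map fun a => ∫⁻ ω, f a ω ∂μ).sum := by
  induction l with
  | nil => simp
  | cons a l ih =>
    simp only [List.map_cons, List.sum_cons]
    rw [lintegral_add_left (hf a), ih]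

theorem measurable_ofReal_natAbs_apply {ι : Type*} (a : ι) :
    Measurable fun ω : ι → ℤ => ENNReal.ofReal ((ω a).natAbs : ℝ) :=
  (measurable_of_countable fun n : ℤ => ENNReal.ofReal (n.natAbs : ℝ)).comp (measurable_pi_apply a)

theorem ofReal_blockNoise {d : ℕ} (J : ℕ × ℕ → ℕ) (ω : CountIndex d → ℤ) (b : ℕ × ℕ) :
    ENNReal.ofReal (blockNoise J ω b) = ENNReal.ofReal (2 ^ b.1 / 2 ^ J b) +
      ∑ j ∈ Finset.Icc 1 (J b), ∑ c ∈ cellLabels d j,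
        ENNReal.ofReal (2 * (2 / 2 ^ j)) * ENNReal.ofReal ((ω (b, j, c)).natAbs : ℝ) := by
  rw [blockNoise, ENNReal.ofReal_add (by positivity) (by positivity)]
  congr 1
  rw [Finset.mul_sum, ENNReal.ofReal_sum_of_nonneg fun j _ => by positivity]
  refine Finset.sum_congr rfl fun j _ => ?_
  rw [← mul_assoc, Finset.mul_sum, ENNReal.ofReal_sum_of_nonneg fun c _ => by positivity]
  exact Finset.sum_congr rfl fun c _ => ENNReal.ofReal_mul (by positivity)

theorem measurable_ofReal_blockNoise {d : ℕ} (J : ℕ × ℕ → ℕ) (b : ℕ × ℕ) :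
    Measurable fun ω : CountIndex d → ℤ => ENNReal.ofReal (blockNoise J ω b) := by
  simp only [ofReal_blockNoise]
  exact measurable_const.add (Finset.measurable_sum _ fun j _ => Finset.measurable_sum _ fun c _ =>
    (measurable_ofReal_natAbs_apply _).const_mul _)

theorem lintegral_blockNoise_le {d : ℕ} (J : ℕ × ℕ → ℕ) (r : ℕ × ℕ → ℕ → {r : ℝ // 0 < r})
    (b : ℕ × ℕ) :
    ∫⁻ ω, ENNReal.ofReal (blockNoise J ω b)
        ∂Measure.infinitePi (fun a : CountIndex d => discreteLaplace (r a.1 a.2.1)) ≤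
      ENNReal.ofReal (4 * ((2 : ℝ) ^ b.1 / 2 ^ J b + ∑ j ∈ Finset.Icc 1 (J b),
        2 / 2 ^ j * ((2 : ℝ) ^ j + 1) ^ d * (1 / (Real.exp (r b j) - 1)))) := by
  set P := Measure.infinitePi (fun a : CountIndex d => discreteLaplace (r a.1 a.2.1))
  have hexp : ∀ j, 0 ≤ 2 / (Real.exp (r b j) - 1) := fun j =>
    div_nonneg two_pos.le (by have := Real.one_lt_exp_iff.2 (r b j).2; linarith)
  have hcoord : ∀ j c, ∫⁻ ω, ENNReal.ofReal ((ω (b, j, c)).natAbs : ℝ) ∂P ≤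
      ENNReal.ofReal (2 / (Real.exp (r b j) - 1)) := by
    intro j c
    refine le_trans (le_of_eq ?_) (lintegral_natAbs_discreteLaplace_le (r b j))
    exact (measurePreserving_eval_infinitePi
      (fun a : CountIndex d => discreteLaplace (r a.1 a.2.1)) (b, j, c)).lintegral_comp
      (measurable_of_countable fun n : ℤ => ENNReal.ofReal (n.natAbs : ℝ))
  simp only [ofReal_blockNoise]
  rw [lintegral_add_left measurable_const, lintegral_const, measure_univ, mul_one,
    lintegral_finsetSum _ fun j _ => Finset.measurable_sum _ fun c _ =>
      (measurable_ofReal_natAbs_apply _).const_mul _]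
  calc _ ≤ ENNReal.ofReal (2 ^ b.1 / 2 ^ J b) + ∑ j ∈ Finset.Icc 1 (J b), ENNReal.ofReal
        (((2 : ℝ) ^ j + 1) ^ d * (2 * (2 / 2 ^ j) * (2 / (Real.exp (r b j) - 1)))) := by
        gcongr with j _
        rw [lintegral_finsetSum _ fun c _ => (measurable_ofReal_natAbs_apply _).const_mul _]
        calc _ ≤ ∑ _c ∈ cellLabels d j,
              ENNReal.ofReal (2 * (2 / 2 ^ j) * (2 / (Real.exp (r b j) - 1))) := by
              refine Finset.sum_le_sum fun c _ => ?_
              rw [lintegral_const_mul _ (measurable_ofReal_natAbs_apply _),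
                ENNReal.ofReal_mul (p := 2 * (2 / 2 ^ j)) (by positivity)]
              gcongr
              exact hcoord j c
          _ = _ := by
              rw [Finset.sum_const, card_cellLabels, nsmul_eq_mul,
                ENNReal.ofReal_mul (p := ((2 : ℝ) ^ j + 1) ^ d) (by positivity)]
              congr 1
              rw [← ENNReal.ofReal_natCast]
              push_cast
              rfl
    _ = ENNReal.ofReal (2 ^ b.1 / 2 ^ J b + ∑ j ∈ Finset.Icc 1 (J b),
        (((2 : ℝ) ^ j + 1) ^ d * (2 * (2 / 2 ^ j) * (2 / (Real.exp (r b j) - 1))))) := by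
        have hnn : ∀ j, 0 ≤ ((2 : ℝ) ^ j + 1) ^ d *
            (2 * (2 / 2 ^ j) * (2 / (Real.exp (r b j) - 1))) := fun j =>
          mul_nonneg (by positivity) (mul_nonneg (by positivity) (hexp j))
        rw [ENNReal.ofReal_add (by positivity) (Finset.sum_nonneg fun j _ => hnn j),
          ENNReal.ofReal_sum_of_nonneg fun j _ => hnn j]
    _ ≤ _ := by
        refine ENNReal.ofReal_le_ofReal ?_
        rw [mul_add, Finset.mul_sum]
        refine add_le_add ?_ (le_of_eq (Finset.sum_congr rfl fun j _ => by ring))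
        have : (0 : ℝ) ≤ 2 ^ b.1 / 2 ^ J b := by positivity
        linarith

theorem ofReal_list_sum {α : Type*} (l : List α) (f : α → ℝ) (hf : ∀ a, 0 ≤ f a) :
    (l.map fun a => ENNReal.ofReal (f a)).sum = ENNReal.ofReal (l.map f).sum := by
  induction l with
  | nil => simp
  | cons a l ih =>
    simp only [List.map_cons, List.sum_cons]
    rw [ih, ENNReal.ofReal_add (hf a)]
    refine List.sum_nonneg fun z hz => ?_
    obtain ⟨a, -, rfl⟩ := List.mem_map.1 hz
    exact hf a

theorem expectedError_noisyCountAlgorithm_le {d : ℕ} (J : ℕ × ℕ → ℕ)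
    (r : ℕ × ℕ → ℕ → {r : ℝ // 0 < r}) {ε C : ℝ} (hε : 0 < ε) (hC : 0 < C)
    (h : ∀ b : ℕ × ℕ, (2 : ℝ) ^ b.1 / 2 ^ J b + ∑ j ∈ Finset.Icc 1 (J b),
        2 / 2 ^ j * ((2 : ℝ) ^ j + 1) ^ d * (1 / (Real.exp (r b j) - 1)) ≤
      C * blockRate d b.1 / (ε / (2 * (Nat.log 2 ((b.2 + 1) * 2 ^ b.1) + 1))))
    (x : DataStream d) {t : ℕ} (ht : 1 ≤ t) :
    (noisyCountAlgorithm J fun a => r a.1 a.2.1).expectedError x t ≤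
      ENNReal.ofReal (16 * C / (ε * t) * ((Nat.log 2 (t + 1) + 1) *
        ∑ k ∈ Finset.range (Nat.log 2 (t + 1)), blockRate d k)) := by
  set K := Nat.log 2 (t + 1) with hK
  set D := 8 * C * ((K : ℝ) + 1) / ε
  have hD : 0 ≤ D := by positivity
  calc (noisyCountAlgorithm J fun a => r a.1 a.2.1).expectedError x t
      ≤ ∫⁻ ω, (t : ℝ≥0∞)⁻¹ * ((dyadicBlocks (t + 1)).map fun b =>
          ENNReal.ofReal (blockNoise J ω b)).sum
        ∂Measure.infinitePi (fun a : CountIndex d => discreteLaplace (r a.1 a.2.1)) := by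
        -- The bound is pointwise in `ω`, so measurability of the Wasserstein distance is not
        -- needed.
        refine lintegral_mono fun ω => ?_
        have e := congrFun (output_noisyCountAlgorithm J (fun a => r a.1 a.2.1) x ω) t
        exact (congrArg (fun z => wassersteinOne (empiricalMeasure (x.upTo t))
          (empiricalMeasure z)) e).le.trans (wassersteinOne_syntheticData_le J x ω t)
    _ = (t : ℝ≥0∞)⁻¹ * ((dyadicBlocks (t + 1)).map fun b =>
          ∫⁻ ω, ENNReal.ofReal (blockNoise J ω b)
            ∂Measure.infinitePi (fun a : CountIndex d => discreteLaplace (r a.1 a.2.1))).sum := by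
        rw [lintegral_const_mul', lintegral_list_sum _ _ _ (measurable_ofReal_blockNoise J)]
        exact ENNReal.inv_ne_top.2 (by exact_mod_cast (by omega : t ≠ 0))
    _ ≤ (t : ℝ≥0∞)⁻¹ * ((dyadicBlocks (t + 1)).map fun b =>
          ENNReal.ofReal (D * blockRate d b.1)).sum := by
        gcongr
        refine List.sum_le_sum fun b hb => (lintegral_blockNoise_le J r b).trans ?_
        refine ENNReal.ofReal_le_ofReal ?_
        -- Every block used ends by `t + 1`, so its budget is at least `ε / (2 (K + 1))`.
        have hle : Nat.log 2 ((b.2 + 1) * 2 ^ b.1) ≤ K :=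
          Nat.log_mono_right (of_mem_dyadicBlocks _ b hb).2.1
        have hle' : (Nat.log 2 ((b.2 + 1) * 2 ^ b.1) : ℝ) ≤ K := by exact_mod_cast hle
        have hrate := blockRate_nonneg d b.1
        calc _ ≤ 4 * (C * blockRate d b.1 /
              (ε / (2 * (Nat.log 2 ((b.2 + 1) * 2 ^ b.1) + 1)))) := by gcongr; exact h b
          _ ≤ 4 * (C * blockRate d b.1 / (ε / (2 * (K + 1)))) := by gcongr
          _ = D * blockRate d b.1 := by simp only [D]; field_simp; ring
    _ = ENNReal.ofReal ((t : ℝ)⁻¹ * ((dyadicBlocks (t + 1)).map fun b =>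
          D * blockRate d b.1).sum) := by
        rw [ofReal_list_sum _ _ fun b => mul_nonneg hD (blockRate_nonneg d _),
          ENNReal.ofReal_mul (by positivity), ENNReal.ofReal_inv_of_pos (by positivity),
          ENNReal.ofReal_natCast]
    _ ≤ _ := by
        refine ENNReal.ofReal_le_ofReal ?_
        have hsum := sum_dyadicBlocks_fst_le (t + 1) (fun k => D * blockRate d k)
          fun k => mul_nonneg hD (blockRate_nonneg d _)
        rw [← Finset.mul_sum, ← hK] at hsum
        calc _ ≤ (t : ℝ)⁻¹ * (2 * (D * ∑ k ∈ Finset.range K, blockRate d k)) := by gcongr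
          _ = _ := by simp only [D]; field_simp; ring

/-! ### Summation of the rates -/

theorem log_add_one_le {t : ℕ} (ht : 2 ≤ t) :
    (Nat.log 2 (t + 1) : ℝ) + 1 ≤ 5 * Real.log t := by
  have ht' : (2 : ℝ) ≤ t := by exact_mod_cast ht
  have h1 : ((2 : ℝ)) ^ Nat.log 2 (t + 1) ≤ t ^ 2 := by
    have : 2 ^ Nat.log 2 (t + 1) ≤ t + 1 := Nat.pow_log_le_self 2 (by omega)
    have h2 : ((2 : ℝ)) ^ Nat.log 2 (t + 1) ≤ t + 1 := by exact_mod_cast this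
    nlinarith
  have h2 := Real.log_le_log (by positivity) h1
  rw [Real.log_pow, Real.log_pow] at h2
  have h3 := Real.log_two_gt_d9
  have h4 := Real.log_le_log two_pos ht'
  push_cast at h2
  nlinarith [Nat.cast_nonneg (α := ℝ) (Nat.log 2 (t + 1))]

/-- A geometric series whose ratio `2^(1-1/d)` is at least `√2`, hence bounded away from `1`: the
largest blocks dominate and no further logarithm appears. -/
theorem sum_blockRate_le_of_two_le {d : ℕ} (hd : 2 ≤ d) {t : ℕ} (ht : 1 ≤ t) :
    ∑ k ∈ Finset.range (Nat.log 2 (t + 1)), blockRate d k ≤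
      6 * (t : ℝ) ^ (1 - 1 / (d : ℝ)) := by
  set K := Nat.log 2 (t + 1)
  have hd' : (2 : ℝ) ≤ d := by exact_mod_cast hd
  have hinv : 1 / (d : ℝ) ≤ 1 / 2 := one_div_le_one_div_of_le two_pos hd'
  have hinv0 : 0 < 1 / (d : ℝ) := by positivity
  set θ := 1 - 1 / (d : ℝ) with hθ
  set ρ := (2 : ℝ) ^ θ with hρ
  have hρ1 : 4 / 3 ≤ ρ := by
    have h1 : (2 : ℝ) ^ (1 / 2 : ℝ) ≤ ρ :=
      Real.rpow_le_rpow_of_exponent_le one_le_two (by linarith)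
    rw [← Real.sqrt_eq_rpow] at h1
    refine le_trans ?_ h1
    exact Real.le_sqrt_of_sq_le (by norm_num)
  have hterm : ∀ k : ℕ, blockRate d k = ρ ^ k := by
    intro k
    rw [blockRate, if_pos hd, hρ, ← Real.rpow_natCast, ← Real.rpow_mul two_pos.le, mul_comm]
  have hKt : ρ ^ K ≤ 2 * (t : ℝ) ^ θ := by
    have h1 : (2 : ℝ) ^ K ≤ 2 * t := by
      have : 2 ^ K ≤ t + 1 := Nat.pow_log_le_self 2 (by omega)
      have h2 : (2 : ℝ) ^ K ≤ t + 1 := by exact_mod_cast this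
      have h3 : (1 : ℝ) ≤ t := by exact_mod_cast ht
      linarith
    calc ρ ^ K = ((2 : ℝ) ^ K) ^ θ := by
          rw [hρ, ← Real.rpow_natCast, ← Real.rpow_natCast, ← Real.rpow_mul two_pos.le,
            ← Real.rpow_mul two_pos.le, mul_comm]
      _ ≤ (2 * (t : ℝ)) ^ θ := Real.rpow_le_rpow (by positivity) h1 (by linarith)
      _ = 2 ^ θ * (t : ℝ) ^ θ := Real.mul_rpow two_pos.le (by positivity)
      _ ≤ 2 * (t : ℝ) ^ θ := by
          gcongr
          calc (2 : ℝ) ^ θ ≤ 2 ^ (1 : ℝ) :=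
                Real.rpow_le_rpow_of_exponent_le one_le_two (by linarith)
            _ = 2 := Real.rpow_one 2
  simp only [hterm]
  rw [geom_sum_eq (by linarith), div_le_iff₀ (by linarith)]
  have : 0 ≤ (t : ℝ) ^ θ := by positivity
  nlinarith

theorem sum_blockRate_one_le (K : ℕ) :
    ∑ k ∈ Finset.range K, blockRate 1 k ≤ ((K : ℝ) + 1) ^ 3 := by
  calc ∑ k ∈ Finset.range K, blockRate 1 k ≤ ∑ _k ∈ Finset.range K, ((K : ℝ) + 1) ^ 2 := by
        refine Finset.sum_le_sum fun k hk => ?_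
        rw [blockRate, if_neg (by norm_num)]
        have : (k : ℝ) ≤ K := by exact_mod_cast (Finset.mem_range.1 hk).le
        gcongr
    _ = K * ((K : ℝ) + 1) ^ 2 := by simp
    _ ≤ ((K : ℝ) + 1) ^ 3 := by nlinarith [sq_nonneg ((K : ℝ) + 1)]

theorem log_mul_sum_blockRate_le {d : ℕ} (hd : 1 ≤ d) {ε : ℝ} (hε : 0 < ε) {t : ℕ} (ht : 2 ≤ t) :
    1 / (ε * t) * ((Nat.log 2 (t + 1) + 1) *
        ∑ k ∈ Finset.range (Nat.log 2 (t + 1)), blockRate d k) ≤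
      1250 * (if 2 ≤ d then ε⁻¹ * Real.log (t : ℝ) * (t : ℝ) ^ (-(1 / (d : ℝ)))
        else (ε * (t : ℝ))⁻¹ * Real.log (t : ℝ) ^ (4.5 : ℝ)) := by
  have hlog := log_add_one_le ht
  have ht0 : (0 : ℝ) < t := by positivity
  set K := Nat.log 2 (t + 1)
  set L := Real.log t
  have hL : 1 / 2 < L := by
    have h3 := Real.log_two_gt_d9
    have h4 := Real.log_le_log two_pos (by exact_mod_cast ht : (2 : ℝ) ≤ t)
    simp only [L]
    linarith
  split_ifs with h2
  · calc 1 / (ε * t) * ((K + 1) * ∑ k ∈ Finset.range K, blockRate d k)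
        ≤ 1 / (ε * t) * ((5 * L) * (6 * (t : ℝ) ^ (1 - 1 / (d : ℝ)))) := by
          gcongr
          · exact Finset.sum_nonneg fun k _ => blockRate_nonneg d k
          · exact sum_blockRate_le_of_two_le h2 (by omega)
      _ = 30 * (ε⁻¹ * L * (t : ℝ) ^ (-(1 / (d : ℝ)))) := by
          rw [sub_eq_add_neg, Real.rpow_add ht0, Real.rpow_one]
          field_simp
          ring
      _ ≤ _ := by
          have : 0 ≤ ε⁻¹ * L * (t : ℝ) ^ (-(1 / (d : ℝ))) := by positivity
          linarith
  · obtain rfl : d = 1 := by omega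
    -- The argument yields the exponent `4`; since `log t > 1/2`, it is absorbed in `4.5` at the
    -- cost of a constant.
    have hpow : L ^ 4 ≤ 2 * L ^ (4.5 : ℝ) := by
      have h5 : L ^ (4.5 : ℝ) = L ^ 4 * Real.sqrt L := by
        rw [Real.sqrt_eq_rpow, ← Real.rpow_natCast, ← Real.rpow_add (by linarith)]
        norm_num
      have h6 : 1 / 2 ≤ Real.sqrt L := Real.le_sqrt_of_sq_le (by linarith)
      rw [h5]
      have : 0 ≤ L ^ 4 := by positivity
      nlinarith
    calc 1 / (ε * t) * ((K + 1) * ∑ k ∈ Finset.range K, blockRate 1 k)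
        ≤ 1 / (ε * t) * ((K + 1) * ((K : ℝ) + 1) ^ 3) := by
          gcongr
          exact sum_blockRate_one_le K
      _ = 1 / (ε * t) * ((K : ℝ) + 1) ^ 4 := by ring
      _ ≤ 1 / (ε * t) * (5 * L) ^ 4 := by gcongr
      _ = 625 * ((ε * t)⁻¹ * L ^ 4) := by ring
      _ ≤ 625 * ((ε * t)⁻¹ * (2 * L ^ (4.5 : ℝ))) := by gcongr
      _ = _ := by ring

theorem theorem1 (d : ℕ) (hd : 1 ≤ d) :
    ∃ C : ℝ, 0 < C ∧ ∀ ε : ℝ, 0 < ε →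
      ∃ M : OnlineAlgorithm d, M.IsDifferentiallyPrivate ε ∧
        ∀ (x : DataStream d) (t : ℕ), 2 ≤ t →
          M.expectedError x t ≤ ENNReal.ofReal
            (C * (if 2 ≤ d then ε⁻¹ * Real.log (t : ℝ) * (t : ℝ) ^ (-(1 / (d : ℝ)))
              else (ε * (t : ℝ))⁻¹ * Real.log (t : ℝ) ^ (4.5 : ℝ))) := by
  obtain ⟨C, hC, hparam⟩ := exists_block_parameters hd
  refine ⟨16 * C * 1250, by positivity, fun ε hε => ?_⟩
  -- The budget uses the end of the block in place of the final time, which does not exist here; the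
  -- `2` accounts for the two cells altered per level.
  choose J r hr herr using fun b : ℕ × ℕ =>
    hparam b.1 (ε / (2 * (Nat.log 2 ((b.2 + 1) * 2 ^ b.1) + 1))) (by positivity)
  refine ⟨noisyCountAlgorithm J fun a => r a.1 a.2.1,
    isDifferentiallyPrivate_noisyCountAlgorithm J r hε hr, fun x t ht => ?_⟩
  refine (expectedError_noisyCountAlgorithm_le J r hε hC herr x (by omega)).trans
    (ENNReal.ofReal_le_ofReal ?_)
  have := mul_le_mul_of_nonneg_left (log_mul_sum_blockRate_le hd hε ht)
    (by positivity : 0 ≤ 16 * C)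
  calc _ = 16 * C * (1 / (ε * t) * ((Nat.log 2 (t + 1) + 1) *
        ∑ k ∈ Finset.range (Nat.log 2 (t + 1)), blockRate d k)) := by ring
    _ ≤ _ := this
    _ = _ := by ring
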